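/- **Corollary (Minimum energy Lizorkin splines).** Let $d\ge 1$, let $\alpha>d$ with $\alpha-d\notin\mathbb N$, and put $n=\lceil\alpha-d-1\rceil$. *Setting.* Let $\mathcal S_{\mathrm{Liz}}(\mathbb R^d)$ be the space of Schwartz functions all of whose moments vanish, with continuous dual $\mathcal S'_{\mathrm{Liz}}(\mathbb R^d)$. For $s\in\mathbb R$ let $(-\Delta)^{s/2}$ be the Fourier multiplier $\|\omega\|^{s}$ ($\omega$ the angular frequency) on $\mathcal S_{\mathrm{Liz}}(\mathbb R^d)$, extended to $\mathcal S'_{\mathrm{Liz}}(\mathbb R^d)$ by duality. Let $\mathcal M(\mathbb R^d)$ be the space of finite signed Borel measures and $\|g\|_{\mathcal M}=\sup\{|\langle g,\varphi\rangle|:\varphi\in\mathcal S_{\mathrm{Liz}}(\mathbb R^d),\ \|\varphi\|_\infty\le1\}$. Let $$\mathcal M^\alpha(\mathbb R^d)=\{(-\Delta)^{-\alpha/2}\mu\in\mathcal S'_{\mathrm{Liz}}(\mathbb R^d):\mu\in\mathcal M(\mathbb R^d)\},$$ with the weak* topology given by its predual $C^\alpha(\mathbb R^d)$, the completion of $\mathcal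 S_{\mathrm{Liz}}(\mathbb R^d)$ for the norm $\|(-\Delta)^{-\alpha/2}\varphi\|_\infty$. Let $$\rho(x)=\frac{\Gamma(\frac{d-\alpha}{2})}{2^\alpha\pi^{d/2}\Gamma(\frac\alpha2)}\,\|x\|^{\alpha-d}.$$ Fix a smooth $\chi:\mathbb R\to\mathbb R$ with $\chi(t)=0$ for $|t|\le1$ and $\chi(t)=1$ for $|t|\ge2$. For $y\in\mathbb R^d$ let $p_y(x)=\chi(\|y\|)\,T_n\{\rho(\cdot-y)\}(x)$, where $T_n$ is the Taylor polynomial of order $n$ around $0$ (and $p_y=0$ for $\|y\|\le 1$). Define the representation operator $P$ on $\mathcal M^\alpha(\mathbb R^d)$ by $$P\{(-\Delta)^{-\alpha/2}\mu\}(x)=\int_{\mathbb R^d}\bigl(\rho(x-y)-p_y(x)\bigr)\,d\mu(y).$$ *Statement.* Let $E:\mathbb R\times\mathbb R\to\mathbb R$ be such that, for every $y\in\mathbb R$, $E(y,\cdot)$ is strictly convex and bounded below. Let $\lambda>0$, $M\in\mathbb N$ and data $(x_m,y_m)\in\mathbb R^d\times\mathbb R$, $m=1,\dots,M$, be given. Then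 the solution set $$S=\operatorname*{arg\,min}_{f\in\mathcal M^\alpha(\mathbb R^d)}\ \sum_{m=1}^M E\bigl(y_m,P\{f\}(x_m)\bigr)+\lambda\,\|(-\Delta)^{\alpha/2}f\|_{\mathcal M}$$ is nonempty and weak* compact, and it is the weak* closure of the convex hull of its extreme points. Every extreme point $f$ of $S$ is of the form $$f=\sum_{k=1}^{K}a_k\,(-\Delta)^{-\alpha/2}\{\delta(\cdot-c_k)\},\qquad P\{f\}(x)=\sum_{k=1}^{K}a_k\bigl(\rho(x-c_k)-p_{c_k}(x)\bigr)\quad(x\in\mathbb R^d),$$ for some $K\le M$, $a_k\in\mathbb R$ and $c_k\in\mathbb R^d$. Here each $p_{c_k}$ is a polynomial of degree at most $n$, and $f$ is the class in $\mathcal S'_{\mathrm{Liz}}(\mathbb R^d)$ of the function $P\{f\}$. -/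

import Mathlib

open Set Filter Topology MeasureTheory
open scoped SchwartzMap FourierTransform ContDiff ENNReal LineDeriv

namespace Liz

section Flat

variable {V : Type} [NormedAddCommGroup V] [InnerProductSpace ℝ V]

/-- All derivatives of `ψ` vanish at the origin. -/
def IsFlat {F : Type} [NormedAddCommGroup F] [NormedSpace ℝ F] (ψ : V → F) : Prop :=
  ∀ n : ℕ, iteratedFDeriv ℝ n ψ 0 = 0

lemma IsFlat.zero {F : Type} [NormedAddCommGroup F] [NormedSpace ℝ F] {ψ : V → F}
    (h : IsFlat ψ) : ψ 0 = 0 := by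
  have := congrArg norm (h 0)
  rwa [norm_iteratedFDeriv_zero, norm_zero, norm_eq_zero] at this

lemma IsFlat.fderivCLM {F : Type} [NormedAddCommGroup F] [NormedSpace ℝ F] {ψ : 𝓢(V, F)}
    (h : IsFlat ψ) : IsFlat (SchwartzMap.fderivCLM ℝ V F ψ) := by
  intro n
  have h1 : (SchwartzMap.fderivCLM ℝ V F ψ : V → V →L[ℝ] F) = fderiv ℝ ψ := by
    ext1 x; simp
  rw [h1, ← norm_eq_zero, norm_iteratedFDeriv_fderiv, h (n + 1), norm_zero]

/-- The Schwartz function `ξ ↦ ⟪ξ, ·⟫ ψ(ξ)`. -/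
noncomputable def innerMul (F : Type) [NormedAddCommGroup F] [NormedSpace ℝ F] :
    𝓢(V, F) →L[ℝ] 𝓢(V, V →L[ℝ] F) :=
  SchwartzMap.smulRightCLM ℝ F (innerSL ℝ)

lemma innerMul_apply {F : Type} [NormedAddCommGroup F] [NormedSpace ℝ F] (ψ : 𝓢(V, F)) (ξ : V) :
    innerMul F ψ ξ = (innerSL ℝ ξ).smulRight (ψ ξ) := by
  simp [innerMul]

lemma IsFlat.innerMul {F : Type} [NormedAddCommGroup F] [NormedSpace ℝ F] {ψ : 𝓢(V, F)}
    (h : IsFlat ψ) : IsFlat (innerMul F ψ) := by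
  intro n
  have h1 : (Liz.innerMul F ψ : V → V →L[ℝ] F)
      = fun ξ => (ContinuousLinearMap.smulRightL ℝ V F) (innerSL ℝ ξ) (ψ ξ) := by
    ext1 x; rw [innerMul_apply]; rfl
  rw [h1, ← norm_le_zero_iff]
  refine (ContinuousLinearMap.norm_iteratedFDeriv_le_of_bilinear (n := n) (N := n)
    (ContinuousLinearMap.smulRightL ℝ V F) (f := fun ξ : V => innerSL ℝ ξ) (g := ψ)
    (innerSL ℝ).contDiff (ψ.smooth n) 0 le_rfl).trans ?_
  simp [h _]

lemma flat_bound (N : ℕ) : ∀ (F : Type) [NormedAddCommGroup F] [NormedSpace ℝ F],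
    ∃ q : Seminorm ℝ 𝓢(V, F), Continuous q ∧
      ∀ ψ : 𝓢(V, F), IsFlat ψ → ∀ ξ, ‖ψ ξ‖ ≤ q ψ * ‖ξ‖ ^ N := by
  induction N with
  | zero =>
    intro F _ _
    refine ⟨SchwartzMap.seminorm ℝ 0 0, (schwartz_withSeminorms ℝ V F).continuous_seminorm (0, 0),
      fun ψ _ ξ => ?_⟩
    simpa using SchwartzMap.norm_le_seminorm ℝ ψ ξ
  | succ N ih =>
    intro F _ _
    obtain ⟨q, hq, hb⟩ := ih (V →L[ℝ] F)
    refine ⟨q.comp (SchwartzMap.fderivCLM ℝ V F).toLinearMap,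
      hq.comp (SchwartzMap.fderivCLM ℝ V F).continuous, fun ψ hψ ξ => ?_⟩
    have key : ∀ x ∈ Metric.closedBall (0 : V) ‖ξ‖,
        ‖fderiv ℝ ψ x‖ ≤ q (SchwartzMap.fderivCLM ℝ V F ψ) * ‖ξ‖ ^ N := by
      intro x hx
      have h2 := hb _ hψ.fderivCLM x
      rw [SchwartzMap.fderivCLM_apply] at h2
      refine h2.trans ?_
      have : ‖x‖ ≤ ‖ξ‖ := by simpa using hx
      have := apply_nonneg q (SchwartzMap.fderivCLM ℝ V F ψ)
      gcongr
    have := (convex_closedBall (0 : V) ‖ξ‖).norm_image_sub_le_of_norm_fderiv_le (𝕜 := ℝ)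
      (fun x _ => ψ.differentiableAt) key (x := 0) (y := ξ) (by simp) (by simp)
    rw [hψ.zero, sub_zero, sub_zero] at this
    refine this.trans (le_of_eq ?_)
    rw [pow_succ, ← mul_assoc]; rfl

/-- Multiplication by `‖ξ‖ ^ s`. -/
noncomputable def normPowMul {F : Type} [NormedAddCommGroup F] [NormedSpace ℝ F] (s : ℝ)
    (ψ : V → F) : V → F := fun ξ => (‖ξ‖ ^ s : ℝ) • ψ ξ

lemma flat_rpow_small (F : Type) [NormedAddCommGroup F] [NormedSpace ℝ F] (s : ℝ) (m : ℕ) :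
    ∃ q : Seminorm ℝ 𝓢(V, F), Continuous q ∧
      ∀ ψ : 𝓢(V, F), IsFlat ψ → ∀ ξ, ‖ξ‖ ≤ 1 → ‖normPowMul s ψ ξ‖ ≤ q ψ * ‖ξ‖ ^ m := by
  obtain ⟨q, hq, hb⟩ := flat_bound (V := V) (⌈|s|⌉₊ + m) F
  refine ⟨q, hq, fun ψ hψ ξ hξ => ?_⟩
  rcases eq_or_ne ξ 0 with rfl | h0
  · simp only [normPowMul, hψ.zero, smul_zero, norm_zero]
    have := apply_nonneg q ψ
    positivity
  have hpos : 0 < ‖ξ‖ := norm_pos_iff.2 h0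
  have h1 : ‖ξ‖ ^ s * ‖ξ‖ ^ (⌈|s|⌉₊) ≤ 1 := by
    rw [← Real.rpow_natCast, ← Real.rpow_add hpos]
    refine Real.rpow_le_one hpos.le hξ ?_
    have := Nat.le_ceil |s|
    have := neg_abs_le s
    linarith
  rw [normPowMul, norm_smul, Real.norm_of_nonneg (by positivity)]
  calc ‖ξ‖ ^ s * ‖ψ ξ‖ ≤ ‖ξ‖ ^ s * (q ψ * ‖ξ‖ ^ (⌈|s|⌉₊ + m)) := by gcongr; exact hb ψ hψ ξ
    _ = (‖ξ‖ ^ s * ‖ξ‖ ^ (⌈|s|⌉₊)) * (q ψ * ‖ξ‖ ^ m) := by rw [pow_add]; ring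
    _ ≤ 1 * (q ψ * ‖ξ‖ ^ m) := by
        have := apply_nonneg q ψ
        gcongr
    _ = _ := one_mul _

lemma flat_rpow_decay (F : Type) [NormedAddCommGroup F] [NormedSpace ℝ F] (s : ℝ) (k : ℕ) :
    ∃ q : Seminorm ℝ 𝓢(V, F), Continuous q ∧
      ∀ ψ : 𝓢(V, F), IsFlat ψ → ∀ ξ, ‖ξ‖ ^ k * ‖normPowMul s ψ ξ‖ ≤ q ψ := by
  obtain ⟨q, hq, hb⟩ := flat_rpow_small (V := V) F s 0
  refine ⟨q + SchwartzMap.seminorm ℝ (k + ⌈|s|⌉₊) 0,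
    hq.add ((schwartz_withSeminorms ℝ V F).continuous_seminorm (k + ⌈|s|⌉₊, 0)),
    fun ψ hψ ξ => ?_⟩
  rw [add_apply]
  have hn1 := apply_nonneg q ψ
  have hn2 := apply_nonneg (SchwartzMap.seminorm ℝ (k + ⌈|s|⌉₊) 0) ψ
  rcases le_total ‖ξ‖ 1 with h | h
  · have h1 := hb ψ hψ ξ h
    rw [pow_zero, mul_one] at h1
    have h2 : ‖ξ‖ ^ k ≤ 1 := pow_le_one₀ (norm_nonneg _) h
    nlinarith [norm_nonneg (normPowMul s ψ ξ)]
  · have h1 := SchwartzMap.norm_pow_mul_le_seminorm ℝ ψ (k + ⌈|s|⌉₊) ξ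
    have h2 : ‖ξ‖ ^ s ≤ ‖ξ‖ ^ ⌈|s|⌉₊ := by
      rw [← Real.rpow_natCast]
      exact Real.rpow_le_rpow_of_exponent_le h ((le_abs_self s).trans (Nat.le_ceil _))
    rw [normPowMul, norm_smul, Real.norm_of_nonneg (by positivity)]
    calc ‖ξ‖ ^ k * (‖ξ‖ ^ s * ‖ψ ξ‖) ≤ ‖ξ‖ ^ k * (‖ξ‖ ^ ⌈|s|⌉₊ * ‖ψ ξ‖) := by gcongr
      _ = ‖ξ‖ ^ (k + ⌈|s|⌉₊) * ‖ψ ξ‖ := by rw [pow_add]; ring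
      _ ≤ _ := by linarith

lemma hasFDerivAt_normPowMul {F : Type} [NormedAddCommGroup F] [NormedSpace ℝ F] (s : ℝ)
    (ψ : 𝓢(V, F)) (hψ : IsFlat ψ) (ξ : V) :
    HasFDerivAt (normPowMul s ψ) (normPowMul s (SchwartzMap.fderivCLM ℝ V F ψ) ξ
      + normPowMul (s - 2) (s • innerMul F ψ) ξ) ξ := by
  rcases eq_or_ne ξ 0 with rfl | h0
  · have e : normPowMul s (SchwartzMap.fderivCLM ℝ V F ψ) 0
      + normPowMul (s - 2) (s • innerMul F ψ) 0 = (0 : V →L[ℝ] F) := by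
      have h1 := hψ.fderivCLM.zero
      have h2 := hψ.innerMul.zero
      simp [normPowMul, h1, h2, -SchwartzMap.fderivCLM_apply]
    rw [e]
    obtain ⟨q, -, hb⟩ := flat_rpow_small (V := V) F s 2
    have hz : normPowMul s ψ 0 = 0 := by simp [normPowMul, hψ.zero]
    rw [hasFDerivAt_iff_isLittleO_nhds_zero]
    simp only [zero_add, hz, sub_zero, zero_apply]
    refine (Asymptotics.IsBigO.of_bound (q ψ) ?_).trans_isLittleO
      (Asymptotics.isLittleO_norm_pow_id (E' := V) one_lt_two)
    filter_upwards [Metric.closedBall_mem_nhds (0 : V) one_pos] with x hx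
    have := hb ψ hψ x (by simpa using hx)
    simpa using this
  · have hpos : 0 < ‖ξ‖ := norm_pos_iff.2 h0
    have hn : HasFDerivAt (fun x : V => ‖x‖ ^ s) ((s * ‖ξ‖ ^ (s - 2)) • innerSL ℝ ξ) ξ := by
      have h1 : HasFDerivAt (fun x : V => (‖x‖ ^ 2) ^ (s / 2))
          (((s / 2) * (‖ξ‖ ^ 2) ^ (s / 2 - 1)) • (2 • innerSL ℝ ξ)) ξ :=
        ((hasStrictFDerivAt_norm_sq ξ).hasFDerivAt).rpow_const (Or.inl (by positivity))
      have h2 : (fun x : V => (‖x‖ ^ 2) ^ (s / 2)) = fun x : V => ‖x‖ ^ s := by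
        ext x
        rw [← Real.rpow_natCast, ← Real.rpow_mul (norm_nonneg _)]
        congr 1; push_cast; ring
      have h3 : (‖ξ‖ ^ 2) ^ (s / 2 - 1) = ‖ξ‖ ^ (s - 2) := by
        rw [← Real.rpow_natCast, ← Real.rpow_mul (norm_nonneg _)]
        congr 1; push_cast; ring
      rw [h2, h3] at h1
      convert h1 using 1
      rw [← Nat.cast_smul_eq_nsmul ℝ, smul_smul]
      congr 1; push_cast; ring
    have := hn.smul (ψ.hasFDerivAt ξ)
    have e : normPowMul s (SchwartzMap.fderivCLM ℝ V F ψ) ξ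
        + normPowMul (s - 2) (s • innerMul F ψ) ξ = ‖ξ‖ ^ s • fderiv ℝ (⇑ψ) ξ
          + ((s * ‖ξ‖ ^ (s - 2)) • (innerSL ℝ) ξ).smulRight (ψ ξ) := by
      ext v
      simp [normPowMul, innerMul_apply, smul_smul]
      ring_nf
    rw [e]
    exact this

lemma normPowMul_main (n : ℕ) : ∀ (F : Type) [NormedAddCommGroup F] [NormedSpace ℝ F] (s : ℝ),
    (∀ ψ : 𝓢(V, F), IsFlat ψ → ContDiff ℝ n (normPowMul s ψ) ∧
      iteratedFDeriv ℝ n (normPowMul s ψ) 0 = 0) ∧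
    ∀ k : ℕ, ∃ q : Seminorm ℝ 𝓢(V, F), Continuous q ∧ ∀ ψ : 𝓢(V, F), IsFlat ψ →
      ∀ ξ, ‖ξ‖ ^ k * ‖iteratedFDeriv ℝ n (normPowMul s ψ) ξ‖ ≤ q ψ := by
  induction n with
  | zero =>
    intro F _ _ s
    refine ⟨fun ψ hψ => ⟨?_, ?_⟩, fun k => ?_⟩
    · have : Differentiable ℝ (normPowMul s ψ) :=
        fun ξ => (hasFDerivAt_normPowMul s ψ hψ ξ).differentiableAt
      exact_mod_cast contDiff_zero.2 this.continuous
    · rw [← norm_eq_zero, norm_iteratedFDeriv_zero]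
      simp [normPowMul, hψ.zero]
    · simpa only [norm_iteratedFDeriv_zero] using flat_rpow_decay F s k
  | succ n ih =>
    intro F _ _ s
    obtain ⟨A1, B1⟩ := ih (V →L[ℝ] F) s
    obtain ⟨A2, B2⟩ := ih (V →L[ℝ] F) (s - 2)
    have hsm : ∀ ψ : 𝓢(V, F), IsFlat ψ → IsFlat (s • innerMul F ψ) := by
      intro ψ hψ m
      have : (⇑(s • Liz.innerMul F ψ) : V → V →L[ℝ] F) = s • ⇑(Liz.innerMul F ψ) := by
        ext1 x; simp
      rw [this, iteratedFDeriv_const_smul_apply ((SchwartzMap.smooth _ m).contDiffAt),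
        hψ.innerMul m, smul_zero]
    have hfd : ∀ ψ : 𝓢(V, F), IsFlat ψ → fderiv ℝ (normPowMul s ψ)
        = normPowMul s (SchwartzMap.fderivCLM ℝ V F ψ)
          + normPowMul (s - 2) (s • innerMul F ψ) := by
      intro ψ hψ
      ext1 ξ
      exact (hasFDerivAt_normPowMul s ψ hψ ξ).fderiv
    have hfd' : ∀ ψ : 𝓢(V, F), IsFlat ψ → ∀ ξ, ‖iteratedFDeriv ℝ (n + 1) (normPowMul s ψ) ξ‖
        ≤ ‖iteratedFDeriv ℝ n (normPowMul s (SchwartzMap.fderivCLM ℝ V F ψ)) ξ‖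
          + ‖iteratedFDeriv ℝ n (normPowMul (s - 2) (s • innerMul F ψ)) ξ‖ := by
      intro ψ hψ ξ
      rw [← norm_iteratedFDeriv_fderiv, hfd ψ hψ, iteratedFDeriv_add_apply
        ((A1 _ hψ.fderivCLM).1.contDiffAt) ((A2 _ (hsm ψ hψ)).1.contDiffAt)]
      exact norm_add_le _ _
    refine ⟨fun ψ hψ => ⟨?_, ?_⟩, fun k => ?_⟩
    · rw [Nat.cast_succ, contDiff_succ_iff_fderiv]
      refine ⟨fun ξ => (hasFDerivAt_normPowMul s ψ hψ ξ).differentiableAt, by simp, ?_⟩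
      rw [hfd ψ hψ]
      exact (A1 _ hψ.fderivCLM).1.add (A2 _ (hsm ψ hψ)).1
    · have := hfd' ψ hψ 0
      rw [(A1 _ hψ.fderivCLM).2, (A2 _ (hsm ψ hψ)).2] at this
      simpa using this
    · obtain ⟨q1, hq1, hb1⟩ := B1 k
      obtain ⟨q2, hq2, hb2⟩ := B2 k
      refine ⟨q1.comp (SchwartzMap.fderivCLM ℝ V F).toLinearMap
          + q2.comp (s • innerMul F).toLinearMap,
        (hq1.comp (SchwartzMap.fderivCLM ℝ V F).continuous).add
          (hq2.comp (s • innerMul F).continuous), fun ψ hψ ξ => ?_⟩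
      have h1 := hb1 _ hψ.fderivCLM ξ
      have h2 := hb2 _ (hsm ψ hψ) ξ
      have h3 := hfd' ψ hψ ξ
      calc _ ≤ ‖ξ‖ ^ k * (‖iteratedFDeriv ℝ n (normPowMul s (SchwartzMap.fderivCLM ℝ V F ψ)) ξ‖
          + ‖iteratedFDeriv ℝ n (normPowMul (s - 2) (s • innerMul F ψ)) ξ‖) := by gcongr
        _ ≤ q1 (SchwartzMap.fderivCLM ℝ V F ψ) + q2 (s • innerMul F ψ) := by
            rw [mul_add]; exact add_le_add h1 h2

/-- The Schwartz functions all of whose derivatives vanish at the origin. -/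
def flatSchwartz (V : Type) [NormedAddCommGroup V] [InnerProductSpace ℝ V] :
    Submodule ℂ 𝓢(V, ℂ) where
  carrier := {ψ | IsFlat ψ}
  zero_mem' := by
    intro n
    have : (⇑(0 : 𝓢(V, ℂ)) : V → ℂ) = 0 := by ext1 x; simp
    rw [this, iteratedFDeriv_zero]
    rfl
  add_mem' := by
    intro f g hf hg n
    have : (⇑(f + g) : V → ℂ) = ⇑f + ⇑g := by ext1 x; simp
    rw [this, iteratedFDeriv_add_apply (f.smooth n).contDiffAt (g.smooth n).contDiffAt, hf n, hg n,
      add_zero]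
  smul_mem' := by
    intro c f hf n
    have : (⇑(c • f) : V → ℂ) = c • ⇑f := by ext1 x; simp
    rw [this, iteratedFDeriv_const_smul_apply (f.smooth n).contDiffAt, hf n, smul_zero]

/-- Multiplication of a flat Schwartz function by `‖ξ‖ ^ s`. -/
noncomputable def normPowSchwartz (s : ℝ) (ψ : flatSchwartz V) : 𝓢(V, ℂ) where
  toFun := normPowMul s ψ.1
  smooth' := contDiff_infty.2 fun n => ((normPowMul_main n ℂ s).1 ψ.1 ψ.2).1
  decay' := fun k n => by
    obtain ⟨q, -, hb⟩ := (normPowMul_main (V := V) n ℂ s).2 k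
    exact ⟨q ψ.1, hb ψ.1 ψ.2⟩

lemma normPowSchwartz_apply (s : ℝ) (ψ : flatSchwartz V) (ξ : V) :
    normPowSchwartz s ψ ξ = (‖ξ‖ ^ s : ℝ) • ψ.1 ξ := rfl

/-- Multiplication by `‖ξ‖ ^ s`, as a linear map. -/
noncomputable def normPowLM (s : ℝ) : flatSchwartz V →ₗ[ℂ] 𝓢(V, ℂ) where
  toFun ψ := normPowSchwartz s ψ
  map_add' f g := by
    ext ξ
    simp [normPowSchwartz_apply]
  map_smul' c f := by
    ext ξ
    simp [normPowSchwartz_apply]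
    ring

lemma continuous_normPowLM (s : ℝ) : Continuous (normPowLM (V := V) s) := by
  change Continuous ((normPowLM (V := V) s).restrictScalars ℝ)
  rw [(schwartz_withSeminorms ℝ V ℂ).continuous_iff_continuous_comp]
  rintro ⟨k, n⟩
  obtain ⟨q, hq, hb⟩ := (normPowMul_main (V := V) n ℂ s).2 k
  refine Seminorm.continuous_of_le
    (q := q.comp ((flatSchwartz V).subtype.restrictScalars ℝ)) (hq.comp continuous_subtype_val) ?_
  intro ψ
  exact SchwartzMap.seminorm_le_bound ℝ k n _ (apply_nonneg _ _) (fun ξ => hb ψ.1 ψ.2 ξ)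

/-- Multiplication by `‖ξ‖ ^ s`, as a continuous linear map. -/
noncomputable def normPowCLM (s : ℝ) : flatSchwartz V →L[ℂ] flatSchwartz V :=
  (⟨normPowLM s, continuous_normPowLM s⟩ : flatSchwartz V →L[ℂ] 𝓢(V, ℂ)).codRestrict
    (flatSchwartz V) fun ψ n => ((normPowMul_main n ℂ s).1 ψ.1 ψ.2).2

lemma hasTemperateGrowth_inner (m : V) : (fun x : V => (inner ℝ x m : ℝ)).HasTemperateGrowth :=
  ((innerSL ℝ).flip m).hasTemperateGrowth

end Flat

section Fourier

variable {V : Type} [NormedAddCommGroup V] [InnerProductSpace ℝ V] [FiniteDimensional ℝ V]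
  [MeasurableSpace V] [BorelSpace V]

lemma iteratedFDeriv_fourier_zero (n : ℕ) : ∀ (m : Fin n → V) (f : 𝓢(V, ℂ)),
    iteratedFDeriv ℝ n (𝓕 f : 𝓢(V, ℂ)) 0 m
      = (-(2 * Real.pi * Complex.I)) ^ n * ∫ x, (∏ i, inner ℝ x (m i) : ℝ) • f x := by
  induction n with
  | zero =>
    intro m f
    simp [SchwartzMap.fourier_coe, Real.fourier_eq]
  | succ n ih =>
    intro m f
    rw [← SchwartzMap.iteratedLineDerivOp_eq_iteratedFDeriv, LineDeriv.iteratedLineDerivOp_succ_right,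
      SchwartzMap.lineDerivOp_fourier_eq, SchwartzMap.iteratedLineDerivOp_eq_iteratedFDeriv, ih,
      pow_succ, mul_assoc (_ ^ n), ← integral_const_mul (-(2 * Real.pi * Complex.I))]
    congr 1
    refine integral_congr_ae (Eventually.of_forall fun x => ?_)
    beta_reduce
    rw [Fin.prod_univ_castSucc]
    simp [SchwartzMap.smulLeftCLM_apply_apply (hasTemperateGrowth_inner (m (Fin.last n))),
      Fin.init]
    ring

end Fourier

/-- The Euclidean space `ℝ^d`. -/
abbrev E (d : ℕ) := EuclideanSpace ℝ (Fin d)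

lemma hasTemperateGrowth_monomial {d : ℕ} (k : Fin d → ℕ) :
    (fun x : E d => ∏ i, x i ^ k i).HasTemperateGrowth := by
  classical
  have h : ∀ s : Finset (Fin d), (fun x : E d => ∏ i ∈ s, x i ^ k i).HasTemperateGrowth := by
    intro s
    induction s using Finset.induction_on with
    | empty => simp
    | insert a s ha ih =>
      simp only [Finset.prod_insert ha]
      refine Function.HasTemperateGrowth.mul (Function.HasTemperateGrowth.pow ?_ _) ih
      exact (EuclideanSpace.proj a : E d →L[ℝ] ℝ).hasTemperateGrowth
  exact h _

lemma integrable_monomial_smul {d : ℕ} (k : Fin d → ℕ) (φ : 𝓢(E d, ℂ)) :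
    Integrable fun x : E d => (∏ i, x i ^ k i) • φ x := by
  have := (SchwartzMap.smulLeftCLM ℂ (fun x : E d => ∏ i, x i ^ k i) φ).integrable (μ := volume)
  simpa only [SchwartzMap.smulLeftCLM_apply (hasTemperateGrowth_monomial k)] using this

/-- The Lizorkin space: the Schwartz functions on `ℝ^d` all of whose moments vanish. -/
def Lizorkin (d : ℕ) : Submodule ℂ 𝓢(E d, ℂ) where
  carrier := {φ | ∀ k : Fin d → ℕ, ∫ x : E d, (∏ i, x i ^ k i) • φ x = 0}
  zero_mem' := by simp
  add_mem' := by
    intro f g hf hg k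
    have := integral_add (integrable_monomial_smul k f) (integrable_monomial_smul k g)
    rw [hf k, hg k, add_zero] at this
    simpa only [add_apply, smul_add] using this
  smul_mem' := by
    intro c f hf k
    have := integral_smul (μ := volume) c fun x : E d => (∏ i, x i ^ k i) • f x
    rw [hf k, smul_zero] at this
    simpa only [smul_apply, smul_comm c] using this

/-- A Schwartz function has vanishing moments iff its Fourier transform is flat at the origin. -/
lemma mem_lizorkin_iff {d : ℕ} (φ : 𝓢(E d, ℂ)) :
    φ ∈ Lizorkin d ↔ 𝓕 φ ∈ flatSchwartz (E d) := by
  classical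
  have e1 : ∀ (n : ℕ) (v : Fin n → Fin d) (x : E d),
      (∏ i, inner ℝ x (EuclideanSpace.basisFun (Fin d) ℝ (v i)) : ℝ)
        = ∏ j, x j ^ (Finset.univ.filter fun i => v i = j).card := by
    intro n v x
    rw [← Finset.prod_fiberwise (s := Finset.univ) (g := v)]
    refine Finset.prod_congr rfl fun j _ => ?_
    rw [Finset.prod_congr rfl (g := fun _ => x j), Finset.prod_const]
    intro i hi
    simp only [Finset.mem_filter, Finset.mem_univ, true_and] at hi
    simp [hi, EuclideanSpace.inner_single_right]
  constructor
  · intro h n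
    apply ContinuousMultilinearMap.toMultilinearMap_injective
    refine Module.Basis.ext_multilinear (fun _ => (EuclideanSpace.basisFun (Fin d) ℝ).toBasis)
      fun v => ?_
    have := iteratedFDeriv_fourier_zero n
      (fun i => EuclideanSpace.basisFun (Fin d) ℝ (v i)) φ
    simp only [e1] at this
    rw [h, mul_zero] at this
    simpa using this
  · intro h k
    let v : Fin (∑ j, k j) → Fin d := fun i => (finSigmaFinEquiv.symm i).1
    have e2 : ∀ x : E d, (∏ i, inner ℝ x (EuclideanSpace.basisFun (Fin d) ℝ (v i)) : ℝ)
        = ∏ j, x j ^ k j := by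
      intro x
      rw [← Equiv.prod_comp finSigmaFinEquiv, Fintype.prod_sigma]
      refine Finset.prod_congr rfl fun j _ => ?_
      simp [v, EuclideanSpace.inner_single_right]
    have h1 := iteratedFDeriv_fourier_zero _
      (fun i => EuclideanSpace.basisFun (Fin d) ℝ (v i)) φ
    have h2 := h (∑ j, k j)
    rw [h2] at h1
    simp only [e2] at h1
    have h3 : (-(2 * Real.pi * Complex.I)) ^ (∑ j, k j) ≠ 0 := by
      simp [Real.pi_ne_zero]
    exact (mul_eq_zero.1 h1.symm).resolve_left h3

/-- The fractional Laplacian `(-Δ)^(s/2)` on the Lizorkin space: the Fourier multiplier with symbol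
`‖ω‖ ^ s` in the angular frequency `ω = 2πξ`. -/
noncomputable def fracLap (d : ℕ) (s : ℝ) : Lizorkin d →L[ℂ] Lizorkin d :=
  (((2 * Real.pi) ^ s : ℝ) : ℂ) • (
    (FourierTransform.fourierInvCLM ℂ 𝓢(E d, ℂ) ∘L (flatSchwartz (E d)).subtypeL ∘L normPowCLM s ∘L
      ((FourierTransform.fourierCLM ℂ 𝓢(E d, ℂ) ∘L (Lizorkin d).subtypeL).codRestrict
        (flatSchwartz (E d)) fun φ => (mem_lizorkin_iff φ.1).1 φ.2)).codRestrict (Lizorkin d)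
      fun φ => by
        rw [mem_lizorkin_iff]
        simp)

lemma fourier_fracLap (d : ℕ) (s : ℝ) (φ : Lizorkin d) (ξ : E d) :
    𝓕 (fracLap d s φ).1 ξ = ((2 * Real.pi * ‖ξ‖) ^ s : ℝ) • 𝓕 φ.1 ξ := by
  have h : (fracLap d s φ).1 = (((2 * Real.pi) ^ s : ℝ) : ℂ) •
      𝓕⁻ (normPowSchwartz s ⟨𝓕 φ.1, (mem_lizorkin_iff φ.1).1 φ.2⟩) := rfl
  rw [h, FourierTransform.fourier_smul, FourierTransform.fourier_fourierInv_eq, smul_apply,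
    normPowSchwartz_apply, Real.mul_rpow (by positivity) (norm_nonneg _)]
  simp [mul_assoc]

/-- Lizorkin distributions: the continuous dual of the Lizorkin space. -/
abbrev LizorkinDist (d : ℕ) := Lizorkin d →L[ℂ] ℂ

/-- The fractional Laplacian `(-Δ)^(s/2)` on Lizorkin distributions, defined by duality:
`⟨(-Δ)^(s/2) f, φ⟩ = ⟨f, (-Δ)^(s/2) φ⟩`. -/
noncomputable def fracLapDist (d : ℕ) (s : ℝ) : LizorkinDist d →ₗ[ℂ] LizorkinDist d where
  toFun f := f ∘L fracLap d s
  map_add' _ _ := rfl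
  map_smul' _ _ := rfl

instance {d : ℕ} (μ : SignedMeasure (E d)) : IsFiniteMeasure μ.variation := by
  rw [← SignedMeasure.totalVariation_eq_variation]
  infer_instance

lemma integrable_signed {d : ℕ} (μ : SignedMeasure (E d)) (φ : BoundedContinuousFunction (E d) ℂ) :
    μ.Integrable φ :=
  φ.integrable _

/-- Integration of bounded continuous functions against a finite signed measure. -/
noncomputable def integralBCF {d : ℕ} (μ : SignedMeasure (E d)) :
    BoundedContinuousFunction (E d) ℂ →L[ℂ] ℂ :=
  LinearMap.mkContinuous
    { toFun := fun φ => ∫ᵛ x, φ x ∂<•μ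
      map_add' := fun f g =>
        VectorMeasure.integral_add (integrable_signed μ f) (integrable_signed μ g)
      map_smul' := fun c f => by
        refine setToFun_smul _ (fun c s x => ?_) c _
        change (μ s) • (c • x) = c • ((μ s) • x)
        rw [smul_comm] }
    (‖(ContinuousLinearMap.lsmul ℝ ℝ (E := ℂ)).flip‖ * μ.variation.real univ) fun φ => by
      refine (VectorMeasure.norm_integral_le_integral_norm).trans ?_
      rw [mul_assoc]
      gcongr
      refine (integral_mono (integrable_signed μ φ).norm (integrable_const ‖φ‖)
        fun x => φ.norm_coe_le_norm x).trans (le_of_eq ?_)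
      rw [integral_const, smul_eq_mul]

/-- A finite signed measure, viewed as a Lizorkin distribution. -/
noncomputable def ofMeasure (d : ℕ) : SignedMeasure (E d) →ₗ[ℝ] LizorkinDist d where
  toFun μ := integralBCF μ ∘L SchwartzMap.toBoundedContinuousFunctionCLM ℂ (E d) ℂ ∘L
    (Lizorkin d).subtypeL
  map_add' μ ν := by
    ext φ
    exact VectorMeasure.integral_add_vectorMeasure
      (integrable_signed μ (SchwartzMap.toBoundedContinuousFunctionCLM ℂ (E d) ℂ φ.1))
      (integrable_signed ν (SchwartzMap.toBoundedContinuousFunctionCLM ℂ (E d) ℂ φ.1))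
  map_smul' c μ := by
    ext φ
    exact VectorMeasure.integral_smul_vectorMeasure _ c

lemma ofMeasure_apply {d : ℕ} (μ : SignedMeasure (E d)) (φ : Lizorkin d) :
    ofMeasure d μ φ = ∫ᵛ x, φ.1 x ∂<•μ := rfl

lemma ofMeasure_dirac {d : ℕ} (c : E d) (φ : Lizorkin d) :
    ofMeasure d (VectorMeasure.dirac c 1) φ = φ.1 c := by
  rw [ofMeasure_apply, VectorMeasure.integral_dirac]
  simp

/-- The total variation norm of a Lizorkin distribution, in dual form:
`‖g‖_M = sup {|⟨g, φ⟩| : φ ∈ S_Liz, ‖φ‖_∞ ≤ 1}`, which is `∞` if `g` is not a bounded measure. -/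
noncomputable def normM {d : ℕ} (g : LizorkinDist d) : ℝ≥0∞ :=
  ⨆ φ : {φ : Lizorkin d // ∀ x, ‖φ.1 x‖ ≤ 1}, ‖g φ.1‖ₑ

/-- The real linear space `M^α(ℝ^d) = {(-Δ)^(-α/2) μ : μ ∈ M(ℝ^d)}` as a subspace of the
Lizorkin distributions, where `M(ℝ^d)` is the space of finite signed Borel measures. -/
noncomputable def nativeSubmodule (d : ℕ) (α : ℝ) : Submodule ℝ (LizorkinDist d) :=
  LinearMap.range ((fracLapDist d (-α)).restrictScalars ℝ ∘ₗ ofMeasure d)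

/-- The space `M^α(ℝ^d)`; as a type of its own, because it carries its weak* topology below. -/
def NativeSpace (d : ℕ) (α : ℝ) : Type := nativeSubmodule d α

noncomputable instance (d : ℕ) (α : ℝ) : AddCommGroup (NativeSpace d α) :=
  inferInstanceAs (AddCommGroup (nativeSubmodule d α))

noncomputable instance (d : ℕ) (α : ℝ) : Module ℝ (NativeSpace d α) :=
  inferInstanceAs (Module ℝ (nativeSubmodule d α))

/-- The Lizorkin distribution underlying an element of `M^α(ℝ^d)`. -/
noncomputable def NativeSpace.toDist {d : ℕ} {α : ℝ} (f : NativeSpace d α) : LizorkinDist d := f.1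

lemma NativeSpace.exists_measure {d : ℕ} {α : ℝ} (f : NativeSpace d α) :
    ∃ μ : SignedMeasure (E d), fracLapDist d (-α) (ofMeasure d μ) = f.toDist := f.2

/-- The measure `(-Δ)^(α/2) f` of an element `f` of `M^α(ℝ^d)`, that is, the `μ` with
`f = (-Δ)^(-α/2) μ`. -/
noncomputable def NativeSpace.measure {d : ℕ} {α : ℝ} (f : NativeSpace d α) : SignedMeasure (E d) :=
  f.exists_measure.choose

lemma NativeSpace.measure_spec {d : ℕ} {α : ℝ} (f : NativeSpace d α) :
    fracLapDist d (-α) (ofMeasure d f.measure) = f.toDist :=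
  f.exists_measure.choose_spec

/-- The Lizorkin space with the norm `φ ↦ ‖(-Δ)^(-α/2) φ‖_∞`. -/
def PredualCore (d : ℕ) (_α : ℝ) : Type := Lizorkin d

noncomputable instance (d : ℕ) (α : ℝ) : AddCommGroup (PredualCore d α) :=
  inferInstanceAs (AddCommGroup (Lizorkin d))

/-- The bounded continuous function `(-Δ)^(-α/2) φ`. -/
noncomputable def PredualCore.toBCF {d : ℕ} {α : ℝ} :
    PredualCore d α →+ BoundedContinuousFunction (E d) ℂ :=
  (SchwartzMap.toBoundedContinuousFunctionCLM ℂ (E d) ℂ ∘L (Lizorkin d).subtypeL ∘L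
    fracLap d (-α) : Lizorkin d →L[ℂ] BoundedContinuousFunction (E d) ℂ).toLinearMap.toAddMonoidHom

noncomputable instance (d : ℕ) (α : ℝ) : SeminormedAddCommGroup (PredualCore d α) :=
  SeminormedAddCommGroup.induced (PredualCore d α) (BoundedContinuousFunction (E d) ℂ)
    PredualCore.toBCF

/-- The predual `C^α(ℝ^d)` of `M^α(ℝ^d)`: the completion of the Lizorkin space for the norm
`φ ↦ ‖(-Δ)^(-α/2) φ‖_∞`. -/
abbrev Predual (d : ℕ) (α : ℝ) := UniformSpace.Completion (PredualCore d α)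

/-- An element of `M^α(ℝ^d)` as a function on the dense subspace of the predual. -/
noncomputable def NativeSpace.evalCore {d : ℕ} {α : ℝ} (f : NativeSpace d α) : PredualCore d α → ℂ :=
  fun φ => f.toDist φ

lemma NativeSpace.uniformContinuous_evalCore {d : ℕ} {α : ℝ} (f : NativeSpace d α) :
    UniformContinuous f.evalCore := by
  have h : f.evalCore = fun φ => integralBCF f.measure (PredualCore.toBCF φ) := by
    ext1 φ
    have := congrArg (fun g : LizorkinDist d => g φ) f.measure_spec
    exact this.symm
  rw [h]
  exact (integralBCF f.measure).uniformContinuous.comp uniformContinuous_comap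

/-- The duality pairing `⟨f, u⟩` of `f ∈ M^α(ℝ^d)` and `u ∈ C^α(ℝ^d)`: the continuous extension
of `φ ↦ ⟨f, φ⟩` from the Lizorkin space to its completion. -/
noncomputable def pairing {d : ℕ} {α : ℝ} (f : NativeSpace d α) : Predual d α → ℂ :=
  UniformSpace.Completion.extension f.evalCore

lemma pairing_coe {d : ℕ} {α : ℝ} (f : NativeSpace d α) (φ : PredualCore d α) :
    pairing f (φ : Predual d α) = f.evalCore φ :=
  UniformSpace.Completion.extension_coe f.uniformContinuous_evalCore φ

/-- The weak* topology of `M^α(ℝ^d)`: the coarsest one for which `f ↦ ⟨f, u⟩` is continuous for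
every `u` in the predual. -/
noncomputable instance (d : ℕ) (α : ℝ) : TopologicalSpace (NativeSpace d α) :=
  ⨅ u : Predual d α, TopologicalSpace.induced (fun f : NativeSpace d α => pairing f u) inferInstance

/-- The radial basis function `ρ(x) = A ‖x‖ ^ (α - d)` with
`A = Γ((d - α) / 2) / (2 ^ α π ^ (d / 2) Γ(α / 2))`. -/
noncomputable def rho (d : ℕ) (α : ℝ) (x : E d) : ℝ :=
  Real.Gamma ((d - α) / 2) / (2 ^ α * Real.pi ^ ((d : ℝ) / 2) * Real.Gamma (α / 2))
    * ‖x‖ ^ (α - d)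

/-- The degree `⌈α - d - 1⌉` of the correction polynomials. -/
noncomputable def deg (d : ℕ) (α : ℝ) : ℕ := ⌈α - d - 1⌉₊

/-- The Taylor polynomial of order `⌈α - d - 1⌉` of `ρ(· - y)` around the origin. -/
noncomputable def taylorPoly (d : ℕ) (α : ℝ) (y x : E d) : ℝ :=
  ∑ j ∈ Finset.range (deg d α + 1),
    ((j.factorial : ℝ))⁻¹ * iteratedFDeriv ℝ j (fun z : E d => rho d α (z - y)) 0 (fun _ => x)

/-- The correction polynomial `p_y(x)`: the Taylor polynomial, switched off for small `y` by the
cutoff function `χ`. -/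
noncomputable def corrPoly (d : ℕ) (α : ℝ) (χ : ℝ → ℝ) (y x : E d) : ℝ :=
  χ ‖y‖ * taylorPoly d α y x

/-- The function `g` is a polynomial of degree at most `n` on `ℝ^d`. -/
def IsPolyOfDegreeLE {d : ℕ} (n : ℕ) (g : E d → ℝ) : Prop :=
  ∃ q : MvPolynomial (Fin d) ℝ, q.totalDegree ≤ n ∧ ∀ x : E d, g x = MvPolynomial.eval (fun i => x i) q

/-- The kernel `h(x, y) = ρ(x - y) - p_y(x)`. -/
noncomputable def kernel (d : ℕ) (α : ℝ) (χ : ℝ → ℝ) (x y : E d) : ℝ :=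
  rho d α (x - y) - corrPoly d α χ y x

/-- The representation operator on `M^α(ℝ^d)`, which sends `f = (-Δ)^(-α/2) μ` to the function
`x ↦ ∫ h(x, y) dμ(y)`. -/
noncomputable def represent {d : ℕ} {α : ℝ} (χ : ℝ → ℝ) (f : NativeSpace d α) (x : E d) : ℝ :=
  ∫ᵛ y, kernel d α χ x y ∂•f.measure

/-- The Lizorkin distribution `f` is the class of the function `g`. -/
def IsClassOf {d : ℕ} (f : LizorkinDist d) (g : E d → ℝ) : Prop :=
  ∀ φ : Lizorkin d, Integrable (fun x => g x • φ.1 x) ∧ f φ = ∫ x, g x • φ.1 x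

/-- The functional `f ↦ ∑ₘ L(yₘ, P f(xₘ)) + lam ‖(-Δ)^(α/2) f‖_M`. -/
noncomputable def objective {d : ℕ} {α : ℝ} (χ : ℝ → ℝ) (L : ℝ → ℝ → ℝ) (lam : ℝ) {M : ℕ}
    (x : Fin M → E d) (y : Fin M → ℝ) (f : NativeSpace d α) : ℝ :=
  ∑ m, L (y m) (represent χ f (x m)) + lam * (normM (fracLapDist d α f.toDist)).toReal

/-- The set of minimizers of the functional over `M^α(ℝ^d)`. -/
def solutionSet (d : ℕ) (α : ℝ) (χ : ℝ → ℝ) (L : ℝ → ℝ → ℝ) (lam : ℝ) {M : ℕ}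
    (x : Fin M → E d) (y : Fin M → ℝ) : Set (NativeSpace d α) :=
  {f | ∀ g : NativeSpace d α, objective χ L lam x y f ≤ objective χ L lam x y g}

end Liz

/-!
The operator `μ ↦ (-Δ)^(-α/2) μ` identifies the finite signed measures with the native space
(`ofSigned`), and turns the problem into the minimization of a convex data term plus a multiple of
the total variation (`tvNorm_eq`), where the data term depends only on the `M` numbers
`∫ kernel(xₘ, y) dμ(y)`.

*The weak\* topology.* Functions whose Fourier transform vanishes near the origin are uniformly
dense in `C₀`, because an integrable Fourier transform has little mass near the origin
(`exists_lizorkin_dist_le`); this is where `d > 0` enters. Hence `(-Δ)^(-α/2)` extends to an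
isometry of the predual onto `C₀` (`predualToC0_surjective`), the dual norm is the total variation
(`normM_ofMeasure`), and the weak\* topology is the one of measures acting on `C₀`. Balls are
relatively compact, being images of pairs of bounded positive measures on the one-point
compactification (`exists_isCompact_superset_tvNorm_le`), and the norm is lower semicontinuous.

*Point evaluations.* For fixed `x` the kernel `ρ(x - y) - p_y(x)` is a Taylor remainder of `ρ` when
`‖y‖ ≥ 2`. It is controlled by the derivatives of `ρ` of order `n + 1 > α - d`, which are
homogeneous of negative degree, so the kernel is in `C₀` (`tendsto_kernel`, `continuous_kernel`) and
evaluation at `x` is weak\* continuous. The direct method gives a nonempty compact set of minimizers,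
which is convex, and the Krein–Milman theorem describes it by its extreme points.

*Extreme points.* Suppose the measure of an extreme minimizer has `M + 1` points in its support,
with disjoint neighbourhoods `Uᵢ`. Some nonzero combination of the restrictions to the `Uᵢ` has
vanishing measurements. Moving along it in both directions leaves the data term alone and changes
the norm at most by opposite amounts, hence by nothing, which contradicts extremality
(`not_extreme_of_disjoint`). So the measure is a sum of at most `M` Dirac masses.

*Green's function.* That `(-Δ)^(-α/2) δ_c` is the class of `ρ(· - c) - p_c` amounts to the
identity `∫ ρ(x - c) φ(x) dx = ((-Δ)^(-α/2) φ)(c)`, since polynomials vanish on Lizorkin functions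
(`isClassOf_fracLapDist_dirac`). It is the Mellin transform in the scale of the Fourier
multiplication formula for Gaussians. The power `‖x‖ ^ (α - d)` with `α > d` requires the integral
for `Γ` at negative arguments, in which the exponential is replaced by its Taylor remainder
(`integral_rpow_mul_expRem`); the subtracted terms are polynomials in `x` and integrate to zero.
-/

namespace Liz

/-! ### Decay of the kernel in its second variable -/

/-- The norms of the derivatives of a positively homogeneous function of degree `b` are positively
homogeneous, and each derivative lowers the degree by one. -/
lemma norm_iteratedFDeriv_of_homogeneous {V : Type} [NormedAddCommGroup V] [NormedSpace ℝ V]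
    (k : ℕ) : ∀ {F : Type} [NormedAddCommGroup F] [NormedSpace ℝ F] (f : V → F) (b : ℝ),
    (∀ r : ℝ, 0 < r → ∀ z, f (r • z) = r ^ b • f z) → ∀ r : ℝ, 0 < r → ∀ z,
      ‖iteratedFDeriv ℝ k f (r • z)‖ = r ^ (b - k) * ‖iteratedFDeriv ℝ k f z‖ := by
  induction k with
  | zero =>
    intro F _ _ f b hf r hr z
    rw [norm_iteratedFDeriv_zero, norm_iteratedFDeriv_zero, hf r hr, norm_smul,
      Real.norm_of_nonneg (by positivity)]
    simp
  | succ k ih =>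
    intro F _ _ f b hf r hr z
    rw [← norm_iteratedFDeriv_fderiv, ← norm_iteratedFDeriv_fderiv,
      ih (fderiv ℝ f) (b - 1) ?_ r hr z]
    · congr 2; push_cast; ring
    · intro s hs w
      have h1 : fderiv ℝ (fun x => f (s • x)) w = s • fderiv ℝ f (s • w) := fderiv_comp_smul s
      have h2 : (fun x => f (s • x)) = (s ^ b : ℝ) • f := by
        ext1 x; exact hf s hs x
      rw [h2, fderiv_const_smul_field] at h1
      rw [Real.rpow_sub hs, Real.rpow_one, div_eq_inv_mul, mul_smul]
      have h3 : (s ^ b : ℝ) • fderiv ℝ f w = s • fderiv ℝ f (s • w) := h1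
      rw [h3, inv_smul_smul₀ hs.ne']

variable {d : ℕ}

lemma contDiffAt_rho (α : ℝ) {z : E d} (hz : z ≠ 0) : ContDiffAt ℝ ∞ (rho d α) z := by
  unfold rho
  exact contDiffAt_const.mul ((contDiffAt_norm ℝ hz).rpow_const_of_ne (norm_ne_zero_iff.2 hz))

lemma continuousAt_iteratedFDeriv_rho (α : ℝ) (j : ℕ) {z : E d} (hz : z ≠ 0) :
    ContinuousAt (iteratedFDeriv ℝ j (rho d α)) z :=
  (contDiffAt_rho α hz).continuousAt_iteratedFDeriv (by exact_mod_cast le_top)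

lemma differentiableAt_iteratedFDeriv_rho (α : ℝ) (j : ℕ) {z : E d} (hz : z ≠ 0) :
    DifferentiableAt ℝ (iteratedFDeriv ℝ j (rho d α)) z :=
  (contDiffAt_rho α hz).differentiableAt_iteratedFDeriv (by exact_mod_cast WithTop.coe_lt_top _)

lemma continuous_rho {α : ℝ} (hα : (d : ℝ) < α) : Continuous (rho d α) := by
  unfold rho
  exact continuous_const.mul (continuous_norm.rpow_const fun _ => Or.inr (by linarith))

/-- By homogeneity, it suffices to bound the derivatives of `ρ` on the unit sphere. -/
lemma exists_bound_iteratedFDeriv_rho (α : ℝ) (k : ℕ) :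
    ∃ C : ℝ, 0 ≤ C ∧ ∀ z : E d, z ≠ 0 →
      ‖iteratedFDeriv ℝ k (rho d α) z‖ ≤ C * ‖z‖ ^ (α - d - k) := by
  have hc : ContinuousOn (fun z => ‖iteratedFDeriv ℝ k (rho d α) z‖)
      (Metric.sphere (0 : E d) 1) := by
    intro z hz
    have : z ≠ 0 := by rintro rfl; simp at hz
    exact (continuousAt_iteratedFDeriv_rho α k this).norm.continuousWithinAt
  obtain ⟨C, hC⟩ := (isCompact_sphere (0 : E d) 1).exists_bound_of_continuousOn hc
  refine ⟨max C 0, le_max_right _ _, fun z hz => ?_⟩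
  have hpos : 0 < ‖z‖ := norm_pos_iff.2 hz
  have hhom : ∀ r : ℝ, 0 < r → ∀ w : E d, rho d α (r • w) = r ^ (α - d) • rho d α w := by
    intro r hr w
    unfold rho
    rw [norm_smul, Real.norm_of_nonneg hr.le, Real.mul_rpow hr.le (norm_nonneg _), smul_eq_mul]
    ring
  have h1 := norm_iteratedFDeriv_of_homogeneous k (rho d α) (α - d) hhom ‖z‖ hpos (‖z‖⁻¹ • z)
  rw [smul_inv_smul₀ hpos.ne'] at h1
  have h2 := hC (‖z‖⁻¹ • z) (by
    rw [mem_sphere_zero_iff_norm, norm_smul, norm_inv, norm_norm, inv_mul_cancel₀ hpos.ne'])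
  rw [norm_norm] at h2
  rw [h1, mul_comm]
  gcongr
  exact h2.trans (le_max_left _ _)

/-- The derivatives of `t ↦ ρ(t x - y)` along a segment that avoids the singularity of `ρ`. -/
lemma iteratedDerivWithin_rho_line (α : ℝ) (x y : E d)
    (h : ∀ t ∈ Icc (0 : ℝ) 1, t • x - y ≠ 0) (j : ℕ) :
    ∀ t ∈ Icc (0 : ℝ) 1, iteratedDerivWithin j (fun t : ℝ => rho d α (t • x - y)) (Icc 0 1) t
      = iteratedFDeriv ℝ j (rho d α) (t • x - y) fun _ => x := by
  induction j with
  | zero => intro t _; simp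
  | succ j ih =>
    intro t ht
    rw [iteratedDerivWithin_succ, derivWithin_congr ih (ih t ht)]
    have h1 : HasDerivAt (fun t : ℝ => t • x - y) x t := by
      simpa using ((hasDerivAt_id t).smul_const x).sub_const y
    have h2 := (differentiableAt_iteratedFDeriv_rho α j (h t ht)).hasFDerivAt.comp_hasDerivAt t h1
    have h3 := ((ContinuousMultilinearMap.apply ℝ (fun _ : Fin j => E d) ℝ
      (fun _ => x)).hasFDerivAt).comp_hasDerivAt t h2
    have h4 := h3.hasDerivWithinAt (s := Icc 0 1)
    refine (h4.derivWithin (uniqueDiffOn_Icc zero_lt_one t ht)).trans ?_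
    rw [iteratedFDeriv_succ_apply_left]
    rfl

lemma taylorPoly_eq (α : ℝ) (y x : E d) : taylorPoly d α y x
    = ∑ j ∈ Finset.range (deg d α + 1),
      ((j.factorial : ℝ))⁻¹ * iteratedFDeriv ℝ j (rho d α) (-y) (fun _ => x) := by
  simp only [taylorPoly, iteratedFDeriv_comp_sub, zero_sub]

/-- Taylor's formula for `ρ` along the segment from `-y` to `x - y`. -/
lemma abs_rho_sub_taylorPoly_le (α : ℝ) (x y : E d) (C : ℝ)
    (h : ∀ t ∈ Icc (0 : ℝ) 1, t • x - y ≠ 0)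
    (hC : ∀ t ∈ Icc (0 : ℝ) 1, ‖iteratedFDeriv ℝ (deg d α + 1) (rho d α) (t • x - y)‖ ≤ C) :
    |rho d α (x - y) - taylorPoly d α y x| ≤ C * ‖x‖ ^ (deg d α + 1) := by
  have hcd : ContDiffOn ℝ ((deg d α : ℕ) + 1) (fun t : ℝ => rho d α (t • x - y)) (Icc 0 1) := by
    intro t ht
    have h1 : ContDiffAt ℝ ∞ (fun t : ℝ => rho d α (t • x - y)) t :=
      ContDiffAt.comp (g := rho d α) (f := fun t : ℝ => t • x - y) t
        (contDiffAt_rho α (h t ht)) (by fun_prop)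
    exact (h1.of_le (by exact_mod_cast le_top)).contDiffWithinAt
  have hC0 : 0 ≤ C := (norm_nonneg _).trans (hC 0 (by simp))
  have key := taylor_mean_remainder_bound (x := 1) (C := C * ‖x‖ ^ (deg d α + 1)) zero_le_one hcd
    (by simp) (by
      intro t ht
      rw [iteratedDerivWithin_rho_line α x y h _ t ht]
      refine (ContinuousMultilinearMap.le_opNorm _ _).trans ?_
      rw [Finset.prod_const, Finset.card_univ, Fintype.card_fin]
      gcongr
      exact hC t ht)
  rw [taylor_within_apply] at key
  have e : ∑ k ∈ Finset.range (deg d α + 1), ((k.factorial : ℝ)⁻¹ * (1 - 0) ^ k) •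
      iteratedDerivWithin k (fun t : ℝ => rho d α (t • x - y)) (Icc 0 1) 0
        = taylorPoly d α y x := by
    rw [taylorPoly_eq]
    refine Finset.sum_congr rfl fun j _ => ?_
    rw [iteratedDerivWithin_rho_line α x y h j 0 (by simp)]
    simp
  rw [e, one_smul, Real.norm_eq_abs] at key
  refine key.trans ?_
  rw [sub_zero, one_pow, mul_one]
  refine div_le_self (by positivity) ?_
  exact_mod_cast Nat.one_le_iff_ne_zero.2 (Nat.factorial_ne_zero _)

lemma lt_deg_add_one {α : ℝ} (hαd : ∀ n : ℕ, α - d ≠ n) : α - d < deg d α + 1 := by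
  have h1 := Nat.le_ceil (α - d - 1)
  refine lt_of_le_of_ne (by unfold deg; linarith) ?_
  have := hαd (deg d α + 1)
  exact_mod_cast this

/-- The correction by Taylor polynomials makes the kernel vanish at infinity: the remainder is
bounded by the derivative of order `deg + 1` of `ρ`, which is homogeneous of negative degree. -/
lemma tendsto_kernel {α : ℝ} (hαd : ∀ n : ℕ, α - d ≠ n)
    {χ : ℝ → ℝ} (hχ1 : ∀ t, 2 ≤ |t| → χ t = 1) (x : E d) :
    Tendsto (kernel d α χ x) (cocompact (E d)) (𝓝 0) := by
  obtain ⟨C, hC0, hC⟩ := exists_bound_iteratedFDeriv_rho (d := d) α (deg d α + 1)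
  have he : 0 < ((deg d α + 1 : ℕ) : ℝ) - (α - d) := by
    have := lt_deg_add_one hαd
    push_cast; linarith
  have hlim : Tendsto (fun y : E d => C * (‖y‖ / 2) ^ (α - d - (deg d α + 1 : ℕ))
      * ‖x‖ ^ (deg d α + 1)) (cocompact (E d)) (𝓝 0) := by
    have h1 : Tendsto (fun y : E d => ‖y‖ / 2) (cocompact (E d)) atTop :=
      tendsto_norm_cocompact_atTop.atTop_div_const two_pos
    have h2 := (tendsto_rpow_neg_atTop he).comp h1
    have h3 := (h2.const_mul C).mul_const (‖x‖ ^ (deg d α + 1))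
    simpa [Function.comp_def] using h3
  refine squeeze_zero_norm' ?_ hlim
  -- For `‖y‖ ≥ 2` the cutoff equals one; for `‖y‖ > 2 ‖x‖` the segment from `-y` to `x - y` stays at
  -- distance `‖y‖ / 2` from the singularity.
  filter_upwards [tendsto_norm_cocompact_atTop.eventually_ge_atTop (max 2 (2 * ‖x‖ + 1))] with y hy
  have hy2 : 2 ≤ ‖y‖ := (le_max_left _ _).trans hy
  have hyx : 2 * ‖x‖ + 1 ≤ ‖y‖ := (le_max_right _ _).trans hy
  have hseg : ∀ t ∈ Icc (0 : ℝ) 1, ‖y‖ / 2 ≤ ‖t • x - y‖ := by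
    intro t ht
    have h1 := norm_sub_norm_le y (t • x)
    rw [norm_smul, Real.norm_of_nonneg ht.1, norm_sub_rev] at h1
    have h2 : t * ‖x‖ ≤ ‖x‖ := mul_le_of_le_one_left (norm_nonneg _) ht.2
    linarith
  have hne : ∀ t ∈ Icc (0 : ℝ) 1, t • x - y ≠ 0 := fun t ht => by
    have := hseg t ht
    exact norm_pos_iff.1 (by linarith)
  rw [kernel, corrPoly, hχ1 ‖y‖ (by rwa [abs_norm]), one_mul, Real.norm_eq_abs]
  refine abs_rho_sub_taylorPoly_le α x y _ hne fun t ht => (hC _ (hne t ht)).trans ?_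
  gcongr ?_ * ?_
  exact Real.rpow_le_rpow_of_nonpos (by linarith) (hseg t ht) (by linarith)

lemma continuous_kernel {α : ℝ} (hα : (d : ℝ) < α)
    {χ : ℝ → ℝ} (hχ : Continuous χ) (hχ0 : ∀ t, |t| ≤ 1 → χ t = 0) (x : E d) :
    Continuous (kernel d α χ x) := by
  unfold kernel
  refine ((continuous_rho hα).comp (continuous_const.sub continuous_id)).sub ?_
  rw [continuous_iff_continuousAt]
  intro y
  rcases eq_or_ne y 0 with rfl | hy
  · -- The cutoff removes the singularity of the Taylor coefficients at the origin.
    refine (continuousAt_const (y := (0 : ℝ))).congr ?_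
    filter_upwards [Metric.ball_mem_nhds (0 : E d) one_pos] with z hz
    rw [mem_ball_zero_iff] at hz
    rw [corrPoly, hχ0 _ (by rw [abs_norm]; exact hz.le), zero_mul]
  · unfold corrPoly
    simp only [taylorPoly_eq]
    refine (hχ.comp continuous_norm).continuousAt.mul (tendsto_finsetSum _ fun j _ => ?_)
    refine ContinuousAt.mul continuousAt_const ?_
    have h1 : ContinuousAt (fun y : E d => iteratedFDeriv ℝ j (rho d α) (-y)) y :=
      ContinuousAt.comp (f := fun y : E d => -y)
        (continuousAt_iteratedFDeriv_rho α j (neg_ne_zero.2 hy)) continuous_neg.continuousAt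
    exact (ContinuousMultilinearMap.apply ℝ (fun _ : Fin j => E d) ℝ
      (fun _ => x)).continuous.continuousAt.comp h1

/-! ### The correction terms are polynomials -/

lemma IsPolyOfDegreeLE.const_mul {n : ℕ} {g : E d → ℝ} (h : IsPolyOfDegreeLE n g) (c : ℝ) :
    IsPolyOfDegreeLE n fun x => c * g x := by
  obtain ⟨q, hq, hg⟩ := h
  refine ⟨MvPolynomial.C c * q, ?_, fun x => by simp [hg]⟩
  refine (MvPolynomial.totalDegree_mul _ _).trans ?_
  simpa using hq

lemma IsPolyOfDegreeLE.sum {n : ℕ} {ι : Type} {s : Finset ι} {g : ι → E d → ℝ}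
    (h : ∀ i ∈ s, IsPolyOfDegreeLE n (g i)) : IsPolyOfDegreeLE n fun x => ∑ i ∈ s, g i x := by
  choose! q hq hg using h
  refine ⟨∑ i ∈ s, q i, MvPolynomial.totalDegree_finsetSum_le hq, fun x => ?_⟩
  rw [map_sum]
  exact Finset.sum_congr rfl fun i hi => hg i hi x

lemma isPolyOfDegreeLE_multilinear {j n : ℕ} (hj : j ≤ n)
    (T : ContinuousMultilinearMap ℝ (fun _ : Fin j => E d) ℝ) :
    IsPolyOfDegreeLE n fun x => T fun _ => x := by
  classical
  have h : (fun x : E d => T fun _ => x) = fun x => ∑ v : Fin j → Fin d,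
      T (fun i => EuclideanSpace.basisFun (Fin d) ℝ (v i)) * ∏ i, x (v i) := by
    ext1 x
    have hx : (fun _ : Fin j => x)
        = fun _ => ∑ l, x l • EuclideanSpace.basisFun (Fin d) ℝ l := by
      ext1 _
      simpa using ((EuclideanSpace.basisFun (Fin d) ℝ).sum_repr x).symm
    rw [hx, ContinuousMultilinearMap.map_sum]
    refine Finset.sum_congr rfl fun v _ => ?_
    rw [ContinuousMultilinearMap.map_smul_univ, smul_eq_mul, mul_comm]
  rw [h]
  refine IsPolyOfDegreeLE.sum fun v _ => IsPolyOfDegreeLE.const_mul ?_ _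
  refine ⟨∏ i, MvPolynomial.X (v i), ?_, fun x => by simp⟩
  refine (MvPolynomial.totalDegree_finsetProd _ _).trans ?_
  simpa using hj

lemma isPolyOfDegreeLE_corrPoly (α : ℝ) (χ : ℝ → ℝ) (c : E d) :
    IsPolyOfDegreeLE (deg d α) (corrPoly d α χ c) := by
  have : corrPoly d α χ c = fun x => χ ‖c‖ * taylorPoly d α c x := rfl
  rw [this]
  refine IsPolyOfDegreeLE.const_mul ?_ _
  refine IsPolyOfDegreeLE.sum fun j hj => IsPolyOfDegreeLE.const_mul ?_ _
  exact isPolyOfDegreeLE_multilinear (Nat.lt_succ_iff.1 (Finset.mem_range.1 hj)) _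

/-! ### The Gamma integral at negative arguments -/

/-- The exponential `e ^ (-u)` minus the first `k` terms of its power series. -/
noncomputable def expRem (k : ℕ) (u : ℝ) : ℝ :=
  Real.exp (-u) - ∑ j ∈ Finset.range k, (-u) ^ j / j.factorial

lemma expRem_zero (u : ℝ) : expRem 0 u = Real.exp (-u) := by simp [expRem]

lemma expRem_succ (k : ℕ) (u : ℝ) : expRem (k + 1) u = expRem k u - (-u) ^ k / k.factorial := by
  rw [expRem, expRem, Finset.sum_range_succ]; ring

lemma expRem_succ_zero (k : ℕ) : expRem (k + 1) 0 = 0 := by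
  simp [expRem, Finset.sum_range_succ']

lemma continuous_expRem (k : ℕ) : Continuous (expRem k) := by
  unfold expRem; fun_prop

lemma hasDerivAt_expRem (k : ℕ) (u : ℝ) : HasDerivAt (expRem (k + 1)) (-(expRem k u)) u := by
  induction k with
  | zero =>
    have h : expRem (0 + 1) = fun u => Real.exp (-u) - 1 := by ext1 u; simp [expRem]
    rw [h, expRem_zero]
    simpa using ((hasDerivAt_neg u).exp).sub_const 1
  | succ k ih =>
    have h : expRem (k + 1 + 1) = fun u => expRem (k + 1) u - (-u) ^ (k + 1) / (k + 1).factorial := by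
      ext1 u; exact expRem_succ _ _
    rw [h, expRem_succ]
    have h2 := ((hasDerivAt_neg u).pow (k + 1)).div_const ((k + 1).factorial : ℝ)
    refine (ih.sub h2).congr_deriv ?_
    rw [Nat.factorial_succ]
    have : (k.factorial : ℝ) ≠ 0 := by positivity
    push_cast
    field_simp
    simp
    ring

/-- The remainders of the exponential series alternate in sign and are bounded by the first omitted
term; this passes from `k` to `k + 1` because `expRem (k + 1)` has derivative `-expRem k`. -/
lemma neg_one_pow_mul_expRem_bounds (k : ℕ) : ∀ u : ℝ, 0 ≤ u →
    0 ≤ (-1) ^ k * expRem k u ∧ (-1) ^ k * expRem k u ≤ u ^ k / k.factorial := by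
  induction k with
  | zero =>
    intro u hu
    simp only [expRem_zero, pow_zero, one_mul, Nat.factorial_zero, Nat.cast_one, div_one]
    exact ⟨(Real.exp_pos _).le, Real.exp_le_one_iff.2 (by linarith)⟩
  | succ k ih =>
    have hd : ∀ u, HasDerivAt (fun u => (-1) ^ (k + 1) * expRem (k + 1) u)
        ((-1) ^ k * expRem k u) u := by
      intro u
      refine ((hasDerivAt_expRem k u).const_mul _).congr_deriv ?_
      ring
    have hp : ∀ u : ℝ, HasDerivAt (fun u : ℝ => u ^ (k + 1) / (k + 1).factorial)
        (u ^ k / k.factorial) u := by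
      intro u
      refine ((hasDerivAt_pow (k + 1) u).div_const _).congr_deriv ?_
      rw [Nat.factorial_succ]
      have : (k.factorial : ℝ) ≠ 0 := by positivity
      push_cast
      field_simp
    intro u hu
    constructor
    · have hm : MonotoneOn (fun u => (-1) ^ (k + 1) * expRem (k + 1) u) (Ici 0) := by
        refine monotoneOn_of_deriv_nonneg (convex_Ici 0)
          (fun u _ => (hd u).continuousAt.continuousWithinAt)
          (fun u _ => (hd u).differentiableAt.differentiableWithinAt) fun v hv => ?_
        rw [(hd v).deriv]
        rw [interior_Ici] at hv
        exact (ih v hv.le).1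
      have := hm (by simp) hu hu
      simpa [expRem_succ_zero] using this
    · have hm : MonotoneOn (fun u => u ^ (k + 1) / (k + 1).factorial
          - (-1) ^ (k + 1) * expRem (k + 1) u) (Ici 0) := by
        refine monotoneOn_of_deriv_nonneg (convex_Ici 0)
          (fun u _ => ((hp u).sub (hd u)).continuousAt.continuousWithinAt)
          (fun u _ => ((hp u).sub (hd u)).differentiableAt.differentiableWithinAt) fun v hv => ?_
        have h := (hp v).fun_sub (hd v)
        rw [h.deriv]
        rw [interior_Ici] at hv
        linarith [(ih v hv.le).2]
      have := hm (by simp) hu hu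
      simpa [expRem_succ_zero] using this

lemma abs_expRem_eq (k : ℕ) {u : ℝ} (hu : 0 ≤ u) : |expRem k u| = (-1) ^ k * expRem k u := by
  rw [← abs_of_nonneg (neg_one_pow_mul_expRem_bounds k u hu).1, abs_mul, abs_pow, abs_neg, abs_one,
    one_pow, one_mul]

lemma abs_expRem_le (k : ℕ) {u : ℝ} (hu : 0 ≤ u) : |expRem k u| ≤ u ^ k := by
  rw [abs_expRem_eq k hu]
  refine (neg_one_pow_mul_expRem_bounds k u hu).2.trans (div_le_self (by positivity) ?_)
  exact_mod_cast Nat.one_le_iff_ne_zero.2 (Nat.factorial_ne_zero _)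

lemma abs_expRem_succ_le (k : ℕ) {u : ℝ} (hu : 0 ≤ u) : |expRem (k + 1) u| ≤ u ^ k := by
  have h1 := (neg_one_pow_mul_expRem_bounds k u hu).1
  rw [abs_expRem_eq _ hu, expRem_succ]
  have h2 : (-1 : ℝ) ^ k * (-u) ^ k = u ^ k := by rw [← mul_pow]; simp
  have h3 : u ^ k / k.factorial ≤ u ^ k := by
    refine div_le_self (by positivity) ?_
    exact_mod_cast Nat.one_le_iff_ne_zero.2 (Nat.factorial_ne_zero _)
  calc (-1) ^ (k + 1) * (expRem k u - (-u) ^ k / k.factorial)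
      = ((-1 : ℝ) ^ k * (-u) ^ k) / k.factorial - (-1) ^ k * expRem k u := by ring
    _ ≤ u ^ k := by rw [h2]; linarith

lemma integrableOn_rpow_mul_expRem (k : ℕ) {s : ℝ} (hs : -(k + 1 : ℝ) < s) (hs' : s < -k) :
    IntegrableOn (fun u : ℝ => u ^ (s - 1) * expRem (k + 1) u) (Ioi 0) := by
  have hm : Measurable (fun u : ℝ => u ^ (s - 1) * expRem (k + 1) u) :=
    (measurable_id.pow_const _).mul (continuous_expRem _).measurable
  rw [← Ioc_union_Ioi_eq_Ioi zero_le_one, integrableOn_union]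
  constructor
  · have h1 : IntegrableOn (fun u : ℝ => u ^ (s + k)) (Ioc 0 1) :=
      (intervalIntegrable_iff_integrableOn_Ioc_of_le zero_le_one).1
        (intervalIntegral.intervalIntegrable_rpow' (by linarith))
    refine Integrable.mono' h1 hm.aestronglyMeasurable ?_
    filter_upwards [ae_restrict_mem measurableSet_Ioc] with u hu
    rw [Real.norm_eq_abs, abs_mul, abs_of_pos (Real.rpow_pos_of_pos hu.1 _)]
    have : u ^ (s + k) = u ^ (s - 1) * u ^ (k + 1) := by
      rw [← Real.rpow_natCast, ← Real.rpow_add hu.1]; congr 1; push_cast; ring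
    rw [this]
    have := Real.rpow_pos_of_pos hu.1 (s - 1)
    gcongr
    exact abs_expRem_le _ hu.1.le
  · have h1 : IntegrableOn (fun u : ℝ => u ^ (s - 1 + k)) (Ioi 1) :=
      integrableOn_Ioi_rpow_of_lt (by linarith) one_pos
    refine Integrable.mono' h1 hm.aestronglyMeasurable ?_
    filter_upwards [ae_restrict_mem measurableSet_Ioi] with u hu
    have hu0 : 0 < u := zero_lt_one.trans hu
    rw [Real.norm_eq_abs, abs_mul, abs_of_pos (Real.rpow_pos_of_pos hu0 _), Real.rpow_add hu0,
      Real.rpow_natCast]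
    have := Real.rpow_pos_of_pos hu0 (s - 1)
    gcongr
    exact abs_expRem_succ_le _ hu0.le

/-- The integral representation of `Γ` by analytic continuation: subtracting the Taylor polynomial
of the exponential moves the strip of convergence to `-(k + 1) < s < -k`. -/
lemma integral_rpow_mul_expRem (k : ℕ) : ∀ s : ℝ, -(k + 1 : ℝ) < s → s < -k →
    ∫ u in Ioi (0 : ℝ), u ^ (s - 1) * expRem (k + 1) u = Real.Gamma s := by
  -- Integration by parts relates the integral at `s` to the one at `s + 1` with one term fewer.
  have step : ∀ (k : ℕ) (s : ℝ), -(k + 1 : ℝ) < s → s < -k →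
      IntegrableOn (fun u : ℝ => u ^ s * expRem k u) (Ioi 0) →
      ∫ u in Ioi (0 : ℝ), u ^ s * expRem k u = Real.Gamma (s + 1) →
      ∫ u in Ioi (0 : ℝ), u ^ (s - 1) * expRem (k + 1) u = Real.Gamma s := by
    intro k s hs hs' hi hint
    have hs0 : s ≠ 0 := by
      have : (0 : ℝ) ≤ k := Nat.cast_nonneg k
      linarith
    have key := integral_Ioi_mul_deriv_eq_deriv_mul (a := 0) (a' := 0) (b' := 0)
      (u := expRem (k + 1)) (u' := fun u => -(expRem k u))
      (v := fun u : ℝ => u ^ s / s) (v' := fun u => u ^ (s - 1))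
      (fun u _ => hasDerivAt_expRem k u)
      (fun u hu => ((Real.hasDerivAt_rpow_const (Or.inl (ne_of_gt hu))).div_const s).congr_deriv
        (by field_simp))
      (by simpa only [mul_comm] using! integrableOn_rpow_mul_expRem k hs hs')
      (by
        refine (hi.const_mul (-s⁻¹)).congr (Eventually.of_forall fun u => ?_)
        simp only [Pi.mul_apply]; ring)
      (by
        have hl : Tendsto (fun u : ℝ => |s|⁻¹ * u ^ (k + 1 + s)) (𝓝[>] 0) (𝓝 0) := by
          have h0 : (0 : ℝ) < k + 1 + s := by linarith
          have h1 := (Real.continuousAt_rpow_const (0 : ℝ) (k + 1 + s) (Or.inr h0.le)).tendsto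
          rw [Real.zero_rpow h0.ne'] at h1
          simpa using (h1.mono_left nhdsWithin_le_nhds).const_mul |s|⁻¹
        refine squeeze_zero_norm' ?_ hl
        filter_upwards [self_mem_nhdsWithin] with u hu
        have hu : 0 < u := hu
        rw [Pi.mul_apply, Real.norm_eq_abs, abs_mul, abs_div, abs_of_pos (Real.rpow_pos_of_pos hu _),
          Real.rpow_add hu, ← Nat.cast_succ, Real.rpow_natCast]
        have h2 := abs_expRem_le (k + 1) hu.le
        have := Real.rpow_pos_of_pos hu s
        calc _ ≤ u ^ (k + 1) * (u ^ s / |s|) := by gcongr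
          _ = _ := by simp only [Nat.succ_eq_add_one]; ring)
      (by
        have hl : Tendsto (fun u : ℝ => |s|⁻¹ * u ^ (-(-s - k))) atTop (𝓝 0) := by
          simpa using (tendsto_rpow_neg_atTop (y := -s - k) (by linarith)).const_mul |s|⁻¹
        refine squeeze_zero_norm' ?_ hl
        filter_upwards [eventually_gt_atTop 0] with u hu
        have h2 := abs_expRem_succ_le k hu.le
        have := Real.rpow_pos_of_pos hu s
        rw [Pi.mul_apply, Real.norm_eq_abs, abs_mul, abs_div, abs_of_pos (Real.rpow_pos_of_pos hu _),
          show -(-s - k) = k + s by ring, Real.rpow_add hu, Real.rpow_natCast]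
        calc _ ≤ u ^ k * (u ^ s / |s|) := by gcongr
          _ = _ := by ring)
    have e1 : ∫ u in Ioi (0 : ℝ), -(expRem k u) * (u ^ s / s) = -s⁻¹ * Real.Gamma (s + 1) := by
      rw [← hint, ← integral_const_mul]
      congr 1; ext1 u; ring
    rw [e1, Real.Gamma_add_one hs0] at key
    simp only [mul_comm (_ ^ (s - 1))]
    rw [key]
    field_simp
    ring
  induction k with
  | zero =>
    intro s hs hs'
    have h1 : 0 < s + 1 := by norm_num at hs; linarith
    have h2 := Real.GammaIntegral_convergent h1
    have h3 := Real.Gamma_eq_integral h1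
    rw [add_sub_cancel_right] at h2 h3
    refine step 0 s (by simpa using hs) (by simpa using hs') ?_ ?_
    · simpa only [expRem_zero, mul_comm] using h2
    · simpa only [expRem_zero, mul_comm] using h3.symm
  | succ k ih =>
    intro s hs hs'
    push_cast at hs hs'
    have a1 : -(k + 1 : ℝ) < s + 1 := by linarith
    have a2 : s + 1 < -(k : ℝ) := by linarith
    have h1 := integrableOn_rpow_mul_expRem k a1 a2
    have h2 := ih (s + 1) a1 a2
    rw [add_sub_cancel_right] at h1 h2
    exact step (k + 1) s (by push_cast; linarith) (by push_cast; linarith) h1 h2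

lemma integrableOn_rpow_mul_expRem_mul (k : ℕ) {s : ℝ} (hs : -(k + 1 : ℝ) < s) (hs' : s < -k)
    {r : ℝ} (hr : 0 ≤ r) :
    IntegrableOn (fun t : ℝ => t ^ (s - 1) * expRem (k + 1) (r * t)) (Ioi 0) := by
  rcases hr.eq_or_lt with rfl | hr
  · simp [expRem_succ_zero]
  have h := (integrableOn_Ioi_comp_mul_left_iff
    (fun u : ℝ => u ^ (s - 1) * expRem (k + 1) u) 0 hr).2
    (by simpa using integrableOn_rpow_mul_expRem k hs hs')
  refine IntegrableOn.congr_fun (h.const_mul (r ^ (s - 1))⁻¹) (fun t ht => ?_) measurableSet_Ioi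
  have ht : 0 < t := ht
  have := Real.rpow_pos_of_pos hr (s - 1)
  simp only [Real.mul_rpow hr.le ht.le]
  field_simp

lemma integral_rpow_mul_expRem_mul (k : ℕ) {s : ℝ} (hs : -(k + 1 : ℝ) < s) (hs' : s < -k)
    {r : ℝ} (hr : 0 ≤ r) :
    ∫ t in Ioi (0 : ℝ), t ^ (s - 1) * expRem (k + 1) (r * t) = r ^ (-s) * Real.Gamma s := by
  have hs0 : s ≠ 0 := by
    have : (0 : ℝ) ≤ k := Nat.cast_nonneg k
    linarith
  rcases hr.eq_or_lt with rfl | hr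
  · simp [expRem_succ_zero, Real.zero_rpow (neg_ne_zero.2 hs0)]
  have h := integral_comp_mul_left_Ioi (fun u : ℝ => u ^ (s - 1) * expRem (k + 1) u) 0 hr
  rw [mul_zero, integral_rpow_mul_expRem k s hs hs', smul_eq_mul] at h
  have e : ∫ t in Ioi (0 : ℝ), (r * t) ^ (s - 1) * expRem (k + 1) (r * t)
      = r ^ (s - 1) * ∫ t in Ioi (0 : ℝ), t ^ (s - 1) * expRem (k + 1) (r * t) := by
    rw [← integral_const_mul]
    refine setIntegral_congr_fun measurableSet_Ioi fun t ht => ?_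
    have ht : 0 < t := ht
    simp only [Real.mul_rpow hr.le ht.le]
    ring
  rw [e] at h
  have h3 : r ^ (-s) = (r ^ (s - 1))⁻¹ * r⁻¹ := by
    rw [← Real.rpow_neg hr.le, ← Real.rpow_neg_one r, ← Real.rpow_add hr]; congr 1; ring
  have := Real.rpow_pos_of_pos hr (s - 1)
  rw [h3, mul_assoc, ← h]
  field_simp

lemma integral_rpow_mul_exp_neg_div {a r : ℝ} (ha : 0 < a) (hr : 0 < r) :
    IntegrableOn (fun t : ℝ => t ^ (-a - 1) * Real.exp (-(r * t⁻¹))) (Ioi 0) ∧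
    ∫ t in Ioi (0 : ℝ), t ^ (-a - 1) * Real.exp (-(r * t⁻¹)) = r ^ (-a) * Real.Gamma a := by
  have e : EqOn (fun x : ℝ => (|(-1 : ℝ)| * x ^ ((-1 : ℝ) - 1)) •
      ((x ^ (-1 : ℝ)) ^ (a - 1) * Real.exp (-(r * x ^ (-1 : ℝ)))))
      (fun t : ℝ => t ^ (-a - 1) * Real.exp (-(r * t⁻¹))) (Ioi 0) := by
    intro t ht
    have ht : 0 < t := ht
    simp only [smul_eq_mul, abs_neg, abs_one, one_mul]
    rw [← Real.rpow_mul ht.le, ← mul_assoc, ← Real.rpow_add ht, Real.rpow_neg_one]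
    congr 2; ring
  have h1 := integrableOn_Ioi_comp_rpow_iff
    (fun t : ℝ => t ^ (a - 1) * Real.exp (-(r * t))) (p := -1) (by norm_num)
  have h2 := integral_comp_rpow_Ioi
    (fun t : ℝ => t ^ (a - 1) * Real.exp (-(r * t))) (p := -1) (by norm_num)
  constructor
  · refine IntegrableOn.congr_fun (h1.2 ?_) e measurableSet_Ioi
    have := integrableOn_rpow_mul_exp_neg_mul_rpow (p := 1) (s := a - 1) (b := r) (by linarith)
      one_pos hr
    simpa using this
  · rw [setIntegral_congr_fun measurableSet_Ioi e] at h2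
    rw [h2, Real.integral_rpow_mul_exp_neg_mul_Ioi ha hr, Real.rpow_neg hr.le, one_div,
      Real.inv_rpow hr.le]

/-! ### Polynomials annihilate the Lizorkin space -/

lemma integrable_eval_smul (q : MvPolynomial (Fin d) ℝ) (φ : 𝓢(E d, ℂ)) :
    Integrable fun x : E d => MvPolynomial.eval (fun i => x i) q • φ x := by
  simp only [MvPolynomial.eval_eq', Finset.sum_smul, mul_smul]
  exact integrable_finsetSum _ fun k _ => (integrable_monomial_smul k φ).fun_smul _

lemma integral_eval_smul (q : MvPolynomial (Fin d) ℝ) (φ : Lizorkin d) :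
    ∫ x : E d, MvPolynomial.eval (fun i => x i) q • φ.1 x = 0 := by
  simp only [MvPolynomial.eval_eq', Finset.sum_smul, mul_smul]
  have hi : ∀ k ∈ q.support, Integrable fun x : E d =>
      MvPolynomial.coeff k q • (∏ i, x i ^ k i) • φ.1 x :=
    fun k _ => (integrable_monomial_smul k φ.1).fun_smul _
  rw [integral_finsetSum _ hi]
  refine Finset.sum_eq_zero fun k _ => ?_
  have h := φ.2 k
  rw [integral_smul, h, smul_zero]

lemma exists_eval_eq_pow_norm_sq (c : E d) (r : ℝ) (j : ℕ) :
    ∃ q : MvPolynomial (Fin d) ℝ, ∀ x : E d,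
      (r * ‖x - c‖ ^ 2) ^ j = MvPolynomial.eval (fun i => x i) q := by
  refine ⟨(MvPolynomial.C r * ∑ i, (MvPolynomial.X i - MvPolynomial.C (c i)) ^ 2) ^ j,
    fun x => ?_⟩
  rw [EuclideanSpace.norm_sq_eq]
  simp

/-! ### The Fourier transform of the radial kernel -/

/-- Against a Lizorkin function, a Gaussian may be replaced by its Taylor remainder, since the
subtracted terms are polynomials. -/
lemma integral_expRem_smul (k : ℕ) (φ : Lizorkin d) (c : E d) {t : ℝ} (ht : 0 < t) :
    ∫ x, expRem k (Real.pi * ‖x - c‖ ^ 2 * t) • φ.1 x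
      = ∫ x, Real.exp (-(Real.pi * ‖x - c‖ ^ 2 * t)) • φ.1 x := by
  choose q hq using fun j => exists_eval_eq_pow_norm_sq c (-(Real.pi * t)) j
  have e : ∀ x : E d, expRem k (Real.pi * ‖x - c‖ ^ 2 * t) • φ.1 x
      = Real.exp (-(Real.pi * ‖x - c‖ ^ 2 * t)) • φ.1 x
        - ∑ j ∈ Finset.range k, ((j.factorial : ℝ)⁻¹ •
          (MvPolynomial.eval (fun i => x i) (q j) • φ.1 x)) := by
    intro x
    rw [expRem, sub_smul, Finset.sum_smul]
    congr 1
    refine Finset.sum_congr rfl fun j _ => ?_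
    rw [← hq j x, smul_smul]
    congr 1
    rw [div_eq_inv_mul]; congr 2; ring
  have hi : ∀ j ∈ Finset.range k, Integrable fun x : E d => ((j.factorial : ℝ)⁻¹ •
      (MvPolynomial.eval (fun i => x i) (q j) • φ.1 x)) :=
    fun j _ => (integrable_eval_smul (q j) φ.1).fun_smul _
  have hg : Integrable fun x : E d => Real.exp (-(Real.pi * ‖x - c‖ ^ 2 * t)) • φ.1 x := by
    refine φ.1.integrable.norm.mono' (by fun_prop) (Eventually.of_forall fun x => ?_)
    rw [norm_smul, Real.norm_of_nonneg (Real.exp_pos _).le]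
    refine mul_le_of_le_one_left (norm_nonneg _) (Real.exp_le_one_iff.2 ?_)
    have := Real.pi_pos
    have : 0 ≤ Real.pi * ‖x - c‖ ^ 2 * t := by positivity
    linarith
  simp only [e]
  rw [integral_sub hg (integrable_finsetSum _ hi), integral_finsetSum _ hi]
  simp only [integral_smul, integral_eval_smul, smul_zero, Finset.sum_const_zero, sub_zero]

/-- The Fourier transform of `φ`, modulated so that its integral is `φ c`. -/
noncomputable def modFourier (φ : 𝓢(E d, ℂ)) (c ξ : E d) : ℂ :=
  Complex.exp (2 * Real.pi * Complex.I * (inner ℝ c ξ : ℝ)) * 𝓕 φ ξ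

lemma continuous_modFourier (φ : 𝓢(E d, ℂ)) (c : E d) : Continuous (modFourier φ c) := by
  unfold modFourier
  have := (𝓕 φ).continuous
  fun_prop

lemma norm_modFourier (φ : 𝓢(E d, ℂ)) (c ξ : E d) : ‖modFourier φ c ξ‖ = ‖𝓕 φ ξ‖ := by
  rw [modFourier, norm_mul, show (2 * Real.pi * Complex.I * (inner ℝ c ξ : ℝ) : ℂ)
    = ((2 * Real.pi * (inner ℝ c ξ : ℝ) : ℝ) : ℂ) * Complex.I by push_cast; ring,
    Complex.norm_exp_ofReal_mul_I, one_mul]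

lemma integral_modFourier (φ : 𝓢(E d, ℂ)) (c : E d) : ∫ ξ, modFourier φ c ξ = φ c := by
  have h : 𝓕⁻ (𝓕 φ) = φ := FourierTransform.fourierInv_fourier_eq φ
  conv_rhs => rw [← h, SchwartzMap.fourierInv_coe, Real.fourierInv_eq']
  congr 1
  ext1 ξ
  rw [modFourier, smul_eq_mul, real_inner_comm]
  congr 2
  push_cast; ring

/-- The multiplication formula for the Fourier transform, with a modulated Gaussian. -/
lemma integral_gaussian_smul (φ : 𝓢(E d, ℂ)) (c : E d) {t : ℝ} (ht : 0 < t) :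
    ∫ x, Real.exp (-(Real.pi * ‖x - c‖ ^ 2 * t)) • φ x
      = (t ^ (-(d / 2 : ℝ))) •
        ∫ ξ, Real.exp (-(Real.pi * ‖ξ‖ ^ 2 * t⁻¹)) • modFourier φ c ξ := by
  have hpi := Real.pi_pos
  have hb : 0 < ((Real.pi / t : ℝ) : ℂ).re := by rw [Complex.ofReal_re]; positivity
  have h := VectorFourier.integral_fourierIntegral_smul_eq_flip (e := Real.fourierChar)
    (μ := (volume : Measure (E d))) (ν := (volume : Measure (E d))) (L := innerₗ (E d))
    (f := fun v => Complex.exp (-((Real.pi / t : ℝ) : ℂ) * ‖v‖ ^ 2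
      + 2 * Real.pi * Complex.I * (inner ℝ c v : ℝ))) (g := φ)
    Real.continuous_fourierChar continuous_inner
    (GaussianFourier.integrable_cexp_neg_mul_sq_norm_add hb _ c) φ.integrable
  rw [flip_innerₗ] at h
  have e1 : ∀ ξ : E d, VectorFourier.fourierIntegral Real.fourierChar volume (innerₗ (E d))
      (fun v => Complex.exp (-((Real.pi / t : ℝ) : ℂ) * ‖v‖ ^ 2
        + 2 * Real.pi * Complex.I * (inner ℝ c v : ℝ))) ξ
      = ((t ^ (d / 2 : ℝ) * Real.exp (-(Real.pi * ‖ξ - c‖ ^ 2 * t)) : ℝ) : ℂ) := by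
    intro ξ
    refine (fourier_gaussian_innerProductSpace' hb c ξ).trans ?_
    have : ((Real.pi : ℂ) / ((Real.pi / t : ℝ) : ℂ)) = ((t : ℝ) : ℂ) := by
      rw [← Complex.ofReal_div]; congr 1; field_simp
    rw [this, Complex.ofReal_mul, Complex.ofReal_exp, Complex.ofReal_cpow ht.le]
    congr 1
    · simp
    · congr 1
      rw [norm_sub_rev]
      push_cast
      have h1 : (Real.pi : ℂ) ≠ 0 := by exact_mod_cast hpi.ne'
      have h2 : (t : ℂ) ≠ 0 := by exact_mod_cast ht.ne'
      field_simp
  have e2 : ∀ ξ : E d, Complex.exp (-((Real.pi / t : ℝ) : ℂ) * ‖ξ‖ ^ 2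
        + 2 * Real.pi * Complex.I * (inner ℝ c ξ : ℝ)) •
        VectorFourier.fourierIntegral Real.fourierChar volume (innerₗ (E d)) (⇑φ) ξ
      = Real.exp (-(Real.pi * ‖ξ‖ ^ 2 * t⁻¹)) • modFourier φ c ξ := by
    intro ξ
    rw [modFourier, SchwartzMap.fourier_coe, Complex.exp_add, smul_eq_mul, Complex.real_smul,
      mul_assoc, Complex.ofReal_exp]
    congr 2
    push_cast; ring
  simp only [e1, e2] at h
  rw [← h, ← integral_smul]
  congr 1
  ext1 x
  rw [Complex.coe_smul, smul_smul, ← mul_assoc, ← Real.rpow_add ht,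
    neg_add_cancel, Real.rpow_zero, one_mul]

lemma integrable_rpow_norm_sub_smul {b : ℝ} (hb : 0 ≤ b) (φ : 𝓢(E d, ℂ)) (c : E d) :
    Integrable fun x => (‖x - c‖ ^ b : ℝ) • φ x := by
  obtain ⟨N, hN⟩ := exists_nat_ge b
  have h1 : Integrable fun x : E d => (2 : ℝ) ^ N * (‖x‖ ^ N * ‖φ x‖)
      + (2 : ℝ) ^ N * (1 + ‖c‖) ^ N * ‖φ x‖ :=
    ((φ.integrable_pow_mul volume N).const_mul _).add (φ.integrable.norm.const_mul _)
  refine h1.mono' ?_ (Eventually.of_forall fun x => ?_)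
  · refine Continuous.aestronglyMeasurable ?_
    exact ((continuous_norm.comp (continuous_id.sub continuous_const)).rpow_const
      fun _ => Or.inr hb).smul φ.continuous
  · rw [norm_smul, Real.norm_of_nonneg (by positivity), ← mul_assoc, ← add_mul]
    gcongr
    have h2 : ‖x - c‖ ≤ ‖x‖ + (1 + ‖c‖) := (norm_sub_le _ _).trans (by linarith)
    have h3 : ‖x - c‖ ^ b ≤ (‖x‖ + (1 + ‖c‖)) ^ N := by
      rw [← Real.rpow_natCast]
      refine (Real.rpow_le_rpow (norm_nonneg _) h2 hb).trans ?_
      refine Real.rpow_le_rpow_of_exponent_le ?_ hN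
      linarith [norm_nonneg x, norm_nonneg c]
    refine h3.trans ?_
    have h4 := add_pow_le (norm_nonneg x) (by positivity : 0 ≤ 1 + ‖c‖) N
    refine h4.trans ?_
    have h5 : (2 : ℝ) ^ (N - 1) ≤ 2 ^ N := pow_le_pow_right₀ one_le_two (Nat.sub_le _ _)
    calc _ ≤ (2 : ℝ) ^ N * (‖x‖ ^ N + (1 + ‖c‖) ^ N) := by gcongr
      _ = _ := by ring

lemma integrable_rpow_norm_smul_modFourier (s : ℝ) (φ : Lizorkin d) (c : E d) :
    Integrable fun ξ => (‖ξ‖ ^ s : ℝ) • modFourier φ.1 c ξ := by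
  have h1 := (normPowSchwartz s ⟨𝓕 φ.1, (mem_lizorkin_iff φ.1).1 φ.2⟩).integrable (μ := volume)
  refine h1.mono ?_ (Eventually.of_forall fun ξ => ?_)
  · exact (measurable_norm.pow_const s).aestronglyMeasurable.smul
      (continuous_modFourier φ.1 c).aestronglyMeasurable
  · rw [normPowSchwartz_apply, norm_smul, norm_smul, norm_modFourier]

lemma fracLap_apply (s : ℝ) (φ : Lizorkin d) (c : E d) :
    (fracLap d s φ).1 c = ((2 * Real.pi) ^ s : ℝ) •
      ∫ ξ, (‖ξ‖ ^ s : ℝ) • modFourier φ.1 c ξ := by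
  rw [← integral_modFourier, ← integral_smul]
  congr 1
  ext1 ξ
  rw [modFourier, fourier_fracLap, Real.mul_rpow (by positivity) (norm_nonneg _), modFourier,
    mul_smul, mul_smul_comm, mul_smul_comm]

/-- The Mellin transform in `t` of the Gaussian multiplication formula. On the left-hand side the
Gaussian may be replaced by a Taylor remainder, because Lizorkin functions have no moments. -/
lemma Gamma_smul_integral_rpow_norm_sub {α : ℝ} (hα : (d : ℝ) < α) (hα0 : 0 < α)
    (hαd : ∀ n : ℕ, α - d ≠ n) (hd : 0 < d) (φ : Lizorkin d) (c : E d) :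
    (Real.pi ^ ((α - d) / 2) * Real.Gamma ((d - α) / 2)) • ∫ x, (‖x - c‖ ^ (α - d) : ℝ) • φ.1 x
      = (Real.pi ^ (-(α / 2)) * Real.Gamma (α / 2)) •
        ∫ ξ, (‖ξ‖ ^ (-α) : ℝ) • modFourier φ.1 c ξ := by
  have hpi := Real.pi_pos
  set s : ℝ := (d - α) / 2 with hs
  -- The point `s` lies inside one of the strips `-(k + 1) < s < -k`, because `α - d = -2s` is not an
  -- even integer.
  obtain ⟨k, hk⟩ : ∃ k : ℕ, k = ⌊-s⌋₊ := ⟨_, rfl⟩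
  have hs0 : 0 ≤ -s := by rw [hs]; linarith
  have hk1 : -(k + 1 : ℝ) < s := by
    have := Nat.lt_floor_add_one (-s)
    rw [hk]; linarith
  have hk2 : s < -k := by
    have h1 := Nat.floor_le hs0
    rw [← hk] at h1
    refine lt_of_le_of_ne (by linarith) fun h => hαd (2 * k) ?_
    push_cast
    linarith
  -- The left-hand side as an iterated integral.
  have hL : Integrable (Function.uncurry fun (x : E d) (t : ℝ) =>
      (t ^ (s - 1) * expRem (k + 1) (Real.pi * ‖x - c‖ ^ 2 * t)) • φ.1 x)
      (volume.prod (volume.restrict (Ioi 0))) := by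
    have hmeas : AEStronglyMeasurable (Function.uncurry fun (x : E d) (t : ℝ) =>
        (t ^ (s - 1) * expRem (k + 1) (Real.pi * ‖x - c‖ ^ 2 * t)) • φ.1 x)
        (volume.prod (volume.restrict (Ioi 0))) := by
      have h1 := continuous_expRem (k + 1)
      have h2 := φ.1.continuous
      refine (Measurable.aestronglyMeasurable ?_)
      refine Measurable.smul ((measurable_snd.pow_const _).mul (Continuous.measurable ?_))
        (Continuous.measurable ?_)
      · fun_prop
      · fun_prop
    rw [integrable_prod_iff hmeas]
    constructor
    · refine Eventually.of_forall fun x => ?_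
      exact (integrableOn_rpow_mul_expRem_mul k hk1 hk2
        (r := Real.pi * ‖x - c‖ ^ 2) (by positivity)).smul_const (φ.1 x)
    · have e : ∀ x : E d, ∫ t in Ioi (0 : ℝ),
          ‖(t ^ (s - 1) * expRem (k + 1) (Real.pi * ‖x - c‖ ^ 2 * t)) • φ.1 x‖
          = ((-1) ^ (k + 1) * Real.Gamma s * Real.pi ^ (-s)) *
            ‖(‖x - c‖ ^ (α - d) : ℝ) • φ.1 x‖ := by
        intro x
        have e1 : ∫ t in Ioi (0 : ℝ),
            ‖(t ^ (s - 1) * expRem (k + 1) (Real.pi * ‖x - c‖ ^ 2 * t)) • φ.1 x‖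
            = ∫ t in Ioi (0 : ℝ), ((-1) ^ (k + 1) * ‖φ.1 x‖) *
              (t ^ (s - 1) * expRem (k + 1) (Real.pi * ‖x - c‖ ^ 2 * t)) := by
          refine setIntegral_congr_fun measurableSet_Ioi fun t ht => ?_
          have ht : 0 < t := ht
          have h0 : 0 ≤ Real.pi * ‖x - c‖ ^ 2 * t := by positivity
          simp only [norm_smul, norm_mul, Real.norm_eq_abs]
          rw [abs_expRem_eq _ h0, abs_of_pos (Real.rpow_pos_of_pos ht _)]
          ring
        rw [e1, integral_const_mul, integral_rpow_mul_expRem_mul k hk1 hk2 (by positivity),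
          Real.mul_rpow hpi.le (by positivity), ← Real.rpow_natCast_mul (norm_nonneg _), norm_smul,
          Real.norm_of_nonneg (by positivity),
          show ((2 : ℕ) : ℝ) * -s = α - d by rw [hs]; push_cast; ring]
        ring
      simp only [Function.uncurry_apply_pair, e]
      exact (integrable_rpow_norm_sub_smul (by linarith) φ.1 c).norm.const_mul _
  -- The right-hand side as an iterated integral.
  have hξ : ∀ᵐ ξ : E d, ξ ≠ 0 := by
    have : Nonempty (Fin d) := ⟨⟨0, hd⟩⟩
    exact compl_mem_ae_iff.2 (measure_singleton (0 : E d))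
  have hR : Integrable (Function.uncurry fun (ξ : E d) (t : ℝ) =>
      (t ^ (-(α / 2) - 1) * Real.exp (-(Real.pi * ‖ξ‖ ^ 2 * t⁻¹))) • modFourier φ.1 c ξ)
      (volume.prod (volume.restrict (Ioi 0))) := by
    have hmeas : AEStronglyMeasurable (Function.uncurry fun (ξ : E d) (t : ℝ) =>
        (t ^ (-(α / 2) - 1) * Real.exp (-(Real.pi * ‖ξ‖ ^ 2 * t⁻¹))) • modFourier φ.1 c ξ)
        (volume.prod (volume.restrict (Ioi 0))) := by
      refine (Measurable.aestronglyMeasurable ?_)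
      refine Measurable.smul ((measurable_snd.pow_const _).mul ?_)
        ((continuous_modFourier φ.1 c).measurable.comp measurable_fst)
      exact (((measurable_fst.norm.pow_const 2).const_mul Real.pi).mul measurable_snd.inv).neg.exp
    rw [integrable_prod_iff hmeas]
    constructor
    · filter_upwards [hξ] with ξ h0
      have : 0 < ‖ξ‖ := norm_pos_iff.2 h0
      have h1 := (integral_rpow_mul_exp_neg_div (half_pos hα0)
        (r := Real.pi * ‖ξ‖ ^ 2) (by positivity)).1
      exact Integrable.smul_const h1 (modFourier φ.1 c ξ)
    · refine ((integrable_rpow_norm_smul_modFourier (-α) φ c).norm.const_mul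
        (Real.Gamma (α / 2) * Real.pi ^ (-(α / 2)))).congr ?_
      filter_upwards [hξ] with ξ h0
      have hpos : 0 < ‖ξ‖ := norm_pos_iff.2 h0
      have e1 : ∫ t in Ioi (0 : ℝ),
          ‖(t ^ (-(α / 2) - 1) * Real.exp (-(Real.pi * ‖ξ‖ ^ 2 * t⁻¹))) • modFourier φ.1 c ξ‖
          = ∫ t in Ioi (0 : ℝ), ‖modFourier φ.1 c ξ‖ *
            (t ^ (-(α / 2) - 1) * Real.exp (-(Real.pi * ‖ξ‖ ^ 2 * t⁻¹))) := by
        refine setIntegral_congr_fun measurableSet_Ioi fun t ht => ?_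
        have ht : 0 < t := ht
        simp only [norm_smul, norm_mul, Real.norm_eq_abs, Real.abs_exp]
        rw [abs_of_pos (Real.rpow_pos_of_pos ht _)]
        ring
      simp only [Function.uncurry_apply_pair]
      rw [e1, integral_const_mul, (integral_rpow_mul_exp_neg_div (half_pos hα0)
        (r := Real.pi * ‖ξ‖ ^ 2) (by positivity)).2, Real.mul_rpow hpi.le (by positivity),
        ← Real.rpow_natCast_mul (norm_nonneg _), norm_smul, Real.norm_of_nonneg (by positivity),
        show ((2 : ℕ) : ℝ) * -(α / 2) = -α by push_cast; ring]
      ring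
  have key := integral_integral_swap hL
  have key2 := integral_integral_swap hR
  have e1 : ∫ x : E d, ∫ t in Ioi (0 : ℝ),
      (t ^ (s - 1) * expRem (k + 1) (Real.pi * ‖x - c‖ ^ 2 * t)) • φ.1 x
      = (Real.pi ^ ((α - d) / 2) * Real.Gamma s) • ∫ x, (‖x - c‖ ^ (α - d) : ℝ) • φ.1 x := by
    rw [← integral_smul]
    congr 1
    ext1 x
    rw [integral_smul_const, integral_rpow_mul_expRem_mul k hk1 hk2 (by positivity),
      Real.mul_rpow hpi.le (by positivity), ← Real.rpow_natCast_mul (norm_nonneg _), smul_smul,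
      show ((2 : ℕ) : ℝ) * -s = α - d by rw [hs]; push_cast; ring,
      show -s = (α - d) / 2 by rw [hs]; ring]
    congr 1; ring
  have e2 : ∫ ξ : E d, ∫ t in Ioi (0 : ℝ),
      (t ^ (-(α / 2) - 1) * Real.exp (-(Real.pi * ‖ξ‖ ^ 2 * t⁻¹))) • modFourier φ.1 c ξ
      = (Real.pi ^ (-(α / 2)) * Real.Gamma (α / 2)) •
        ∫ ξ, (‖ξ‖ ^ (-α) : ℝ) • modFourier φ.1 c ξ := by
    rw [← integral_smul]
    refine integral_congr_ae ?_
    filter_upwards [hξ] with ξ h0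
    have hpos : 0 < ‖ξ‖ := norm_pos_iff.2 h0
    rw [integral_smul_const, (integral_rpow_mul_exp_neg_div (half_pos hα0)
        (r := Real.pi * ‖ξ‖ ^ 2) (by positivity)).2, Real.mul_rpow hpi.le (by positivity),
      ← Real.rpow_natCast_mul (norm_nonneg _), smul_smul,
      show ((2 : ℕ) : ℝ) * -(α / 2) = -α by push_cast; ring]
    congr 1; ring
  rw [← e1, ← e2, key, key2]
  refine setIntegral_congr_fun measurableSet_Ioi fun t ht => ?_
  have ht : 0 < t := ht
  simp only [mul_smul, integral_smul]
  rw [integral_expRem_smul _ φ c ht, integral_gaussian_smul φ.1 c ht, smul_smul,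
    ← Real.rpow_add ht]
  congr 2
  rw [hs]; ring

/-- The function `ρ` is a Green's function of `(-Δ)^(α/2)` modulo polynomials. -/
lemma fracLap_neg_apply {α : ℝ} (hα : (d : ℝ) < α)
    (hαd : ∀ n : ℕ, α - d ≠ n) (hd : 0 < d) (φ : Lizorkin d) (c : E d) :
    (fracLap d (-α) φ).1 c = ∫ x, rho d α (x - c) • φ.1 x := by
  have hpi := Real.pi_pos
  have hα0 : 0 < α := lt_of_le_of_lt (Nat.cast_nonneg d) hα
  have hG : 0 < Real.Gamma (α / 2) := Real.Gamma_pos_of_pos (half_pos hα0)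
  have key := Gamma_smul_integral_rpow_norm_sub hα hα0 hαd hd φ c
  rw [fracLap_apply]
  unfold rho
  simp only [mul_smul, integral_smul]
  have hG2 : 0 < Real.pi ^ (-(α / 2)) * Real.Gamma (α / 2) := by positivity
  have c1 : (2 * Real.pi) ^ (-α) = (2 * Real.pi) ^ (-α) / (Real.pi ^ (-(α / 2)) * Real.Gamma (α / 2))
      * (Real.pi ^ (-(α / 2)) * Real.Gamma (α / 2)) := by field_simp
  have c2 : Real.Gamma ((d - α) / 2) / (2 ^ α * Real.pi ^ ((d : ℝ) / 2) * Real.Gamma (α / 2))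
      = (2 * Real.pi) ^ (-α) / (Real.pi ^ (-(α / 2)) * Real.Gamma (α / 2))
        * (Real.pi ^ ((α - d) / 2) * Real.Gamma ((d - α) / 2)) := by
    have p1 : Real.pi ^ (-α) * Real.pi ^ ((α - d) / 2) * Real.pi ^ ((d : ℝ) / 2)
        = Real.pi ^ (-(α / 2)) := by
      rw [← Real.rpow_add hpi, ← Real.rpow_add hpi]; congr 1; ring
    rw [Real.mul_rpow zero_le_two hpi.le, Real.rpow_neg zero_le_two, ← p1]
    field_simp
  rw [c1, mul_smul, ← key, c2, smul_smul]

lemma isClassOf_fracLapDist_dirac {α : ℝ} (hα : (d : ℝ) < α)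
    (hαd : ∀ n : ℕ, α - d ≠ n) (hd : 0 < d) (χ : ℝ → ℝ) (c : E d) :
    IsClassOf (fracLapDist d (-α) (ofMeasure d (VectorMeasure.dirac c 1)))
      fun z => rho d α (z - c) - corrPoly d α χ c z := by
  intro φ
  obtain ⟨q, -, hq⟩ := isPolyOfDegreeLE_corrPoly α χ c
  have h1 : Integrable fun x => rho d α (x - c) • φ.1 x := by
    unfold rho
    simp only [mul_smul]
    exact (integrable_rpow_norm_sub_smul (by linarith) φ.1 c).fun_smul _
  have h2 := integrable_eval_smul q φ.1
  simp only [sub_smul, hq]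
  refine ⟨h1.sub h2, ?_⟩
  rw [integral_sub h1 h2, integral_eval_smul, sub_zero, ← fracLap_neg_apply hα hαd hd]
  exact ofMeasure_dirac c (fracLap d (-α) φ)

lemma IsClassOf.sum_smul {ι : Type} (s : Finset ι) {f : ι → LizorkinDist d} {g : ι → E d → ℝ}
    (h : ∀ i ∈ s, IsClassOf (f i) (g i)) (a : ι → ℝ) :
    IsClassOf (∑ i ∈ s, a i • f i) fun z => ∑ i ∈ s, a i * g i z := by
  intro φ
  have hi : ∀ i ∈ s, Integrable fun x => (a i * g i x) • φ.1 x := fun i hi => by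
    simp only [mul_smul]
    exact ((h i hi φ).1).fun_smul _
  simp only [Finset.sum_smul]
  refine ⟨integrable_finsetSum _ hi, ?_⟩
  rw [integral_finsetSum _ hi, sum_apply]
  refine Finset.sum_congr rfl fun i hi => ?_
  simp only [mul_smul, integral_smul]
  rw [← (h i hi φ).2]
  rfl

/-! ### Uniform density of the Lizorkin space -/

/-- Smooth the function uniformly, then cut it off where it is already small. -/
lemma exists_schwartz_dist_le (g : ZeroAtInftyContinuousMap (E d) ℂ) {ε : ℝ} (hε : 0 < ε) :
    ∃ φ : 𝓢(E d, ℂ), ∀ x, ‖φ x - g x‖ ≤ ε := by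
  obtain ⟨h, hh, hhg⟩ := (ZeroAtInftyContinuousMap.uniformContinuous g).exists_contDiff_dist_le
    (half_pos hε)
  have hz : ∀ᶠ x in cocompact (E d), ‖g x‖ < ε / 2 := by
    have := (zero_at_infty g).norm
    rw [norm_zero] at this
    exact this.eventually_lt_const (half_pos hε)
  rw [← Metric.cobounded_eq_cocompact, (Metric.hasBasis_cobounded_compl_closedBall (0 : E d)).eventually_iff]
    at hz
  obtain ⟨R, -, hR⟩ := hz
  let η : ContDiffBump (0 : E d) := ⟨max R 1, max R 1 + 1, by positivity, by linarith⟩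
  have hsm : ContDiff ℝ ∞ fun x => η x • h x := η.contDiff.smul hh
  have hcs : HasCompactSupport fun x => η x • h x := η.hasCompactSupport.smul_right
  refine ⟨hcs.toSchwartzMap hsm, fun x => ?_⟩
  change ‖η x • h x - g x‖ ≤ ε
  have h1 : ‖h x - g x‖ ≤ ε / 2 := by rw [← dist_eq_norm]; exact (hhg x).le
  by_cases hx : x ∈ Metric.closedBall (0 : E d) R
  · have : η x = 1 := η.one_of_mem_closedBall
      (Metric.closedBall_subset_closedBall (le_max_left _ _) hx)
    rw [this, one_smul]
    linarith
  · have h2 := hR hx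
    have e : η x • h x - g x = η x • (h x - g x) - (1 - η x) • g x := by
      rw [smul_sub, sub_smul, one_smul]; ring
    have h3 := η.nonneg (x := x)
    have h4 := η.le_one (x := x)
    rw [e]
    refine (norm_sub_le _ _).trans ?_
    rw [norm_smul, norm_smul, Real.norm_of_nonneg h3, Real.norm_of_nonneg (sub_nonneg.2 h4)]
    nlinarith [norm_nonneg (h x - g x), norm_nonneg (g x)]

/-- Cutting the Fourier transform off near the origin changes a Schwartz function by an arbitrarily
small amount in the uniform norm, and turns it into a Lizorkin function. -/
lemma exists_lizorkin_dist_schwartz_le (hd : 0 < d) (φ : 𝓢(E d, ℂ)) {ε : ℝ} (hε : 0 < ε) :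
    ∃ ψ : Lizorkin d, ∀ x, ‖ψ.1 x - φ x‖ ≤ ε := by
  obtain ⟨r, hr, hrε⟩ : ∃ r > 0, ∫ ξ in Metric.ball (0 : E d) r, ‖𝓕 φ ξ‖ < ε := by
    have hnull : volume ({0} : Set (E d)) = 0 := by
      have : Nonempty (Fin d) := ⟨⟨0, hd⟩⟩
      exact measure_singleton _
    have hi : Integrable fun ξ => ‖𝓕 φ ξ‖ := (𝓕 φ).integrable.norm
    have hlim : Tendsto (fun n : ℕ => ∫ ξ in Metric.ball (0 : E d) (1 / (n + 1)), ‖𝓕 φ ξ‖) atTop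
        (𝓝 0) := by
      have h1 := tendsto_setIntegral_of_antitone (μ := volume) (f := fun ξ => ‖𝓕 φ ξ‖)
        (s := fun n : ℕ => Metric.ball (0 : E d) (1 / (n + 1))) (fun n => measurableSet_ball)
        (fun m n hmn => Metric.ball_subset_ball (by gcongr)) ⟨0, hi.integrableOn⟩
      have h2 : ⋂ n : ℕ, Metric.ball (0 : E d) (1 / ((n : ℝ) + 1)) = {0} := by
        ext x
        simp only [mem_iInter, mem_ball_zero_iff, mem_singleton_iff]
        constructor
        · intro hx
          by_contra h0
          obtain ⟨n, hn⟩ := exists_nat_one_div_lt (norm_pos_iff.2 h0)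
          exact absurd (hx n) (not_lt.2 hn.le)
        · rintro rfl n
          rw [norm_zero]; positivity
      rw [h2, setIntegral_measure_zero _ hnull] at h1
      exact h1
    obtain ⟨n, hn⟩ := (hlim.eventually_lt_const hε).exists
    exact ⟨1 / (n + 1), by positivity, hn⟩
  let η : ContDiffBump (0 : E d) := ⟨r / 2, r, half_pos hr, half_lt_self hr⟩
  have hsm : ContDiff ℝ ∞ fun ξ => η ξ • 𝓕 φ ξ := η.contDiff.smul (𝓕 φ).smooth'
  have hcs : HasCompactSupport fun ξ => η ξ • 𝓕 φ ξ := η.hasCompactSupport.smul_right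
  set κ : 𝓢(E d, ℂ) := hcs.toSchwartzMap hsm with hκ
  have hκa : ∀ ξ, κ ξ = η ξ • 𝓕 φ ξ := fun ξ => rfl
  have hmem : φ - 𝓕⁻ κ ∈ Lizorkin d := by
    have hF : 𝓕 (φ - 𝓕⁻ κ) = 𝓕 φ - κ := by
      have := map_sub (FourierTransform.fourierCLM ℂ 𝓢(E d, ℂ)) φ (𝓕⁻ κ)
      simpa using this
    rw [mem_lizorkin_iff, hF]
    intro n
    have h0 : (⇑(𝓕 φ - κ) : E d → ℂ) =ᶠ[𝓝 0] 0 := by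
      filter_upwards [Metric.ball_mem_nhds (0 : E d) (half_pos hr)] with ξ hξ
      have : η ξ = 1 := η.one_of_mem_closedBall (Metric.ball_subset_closedBall hξ)
      rw [sub_apply, hκa, this, one_smul, sub_self]; rfl
    rw [(h0.iteratedFDeriv ℝ n).eq_of_nhds, iteratedFDeriv_zero]
    rfl
  refine ⟨⟨φ - 𝓕⁻ κ, hmem⟩, fun x => ?_⟩
  have e : (φ - 𝓕⁻ κ) x - φ x = -(𝓕⁻ κ x) := by rw [sub_apply]; ring
  change ‖(φ - 𝓕⁻ κ) x - φ x‖ ≤ ε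
  rw [e, norm_neg, SchwartzMap.fourierInv_coe, Real.fourierInv_eq]
  refine (norm_integral_le_integral_norm _).trans (le_trans ?_ hrε.le)
  rw [← integral_indicator measurableSet_ball]
  refine integral_mono_of_nonneg (Eventually.of_forall fun _ => norm_nonneg _)
    ((𝓕 φ).integrable.norm.indicator measurableSet_ball) (Eventually.of_forall fun ξ => ?_)
  simp only [Circle.norm_smul, hκa, norm_smul, Real.norm_of_nonneg η.nonneg]
  by_cases hξ : ξ ∈ Metric.ball (0 : E d) r
  · rw [indicator_of_mem hξ]
    exact mul_le_of_le_one_left (norm_nonneg _) η.le_one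
  · rw [indicator_of_notMem hξ, η.zero_of_le_dist (not_lt.1 hξ), zero_mul]

lemma exists_lizorkin_dist_le (hd : 0 < d) (g : ZeroAtInftyContinuousMap (E d) ℂ) {ε : ℝ}
    (hε : 0 < ε) : ∃ ψ : Lizorkin d, ∀ x, ‖ψ.1 x - g x‖ ≤ ε := by
  obtain ⟨φ, hφ⟩ := exists_schwartz_dist_le g (half_pos hε)
  obtain ⟨ψ, hψ⟩ := exists_lizorkin_dist_schwartz_le hd φ (half_pos hε)
  refine ⟨ψ, fun x => ?_⟩
  have := norm_sub_le_norm_sub_add_norm_sub (ψ.1 x) (φ x) (g x)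
  linarith [hφ x, hψ x]

/-! ### Integration against signed measures -/

lemma norm_lsmul_flip_le (F : Type) [NormedAddCommGroup F] [NormedSpace ℝ F] :
    ‖(ContinuousLinearMap.lsmul ℝ ℝ (E := F)).flip‖ ≤ 1 := by
  rw [ContinuousLinearMap.opNorm_flip]
  exact ContinuousLinearMap.opNorm_lsmul_le

lemma norm_integral_signed_le {F : Type} [NormedAddCommGroup F] [NormedSpace ℝ F]
    (μ : SignedMeasure (E d)) {f : E d → F} {C : ℝ} (hC : ∀ x, ‖f x‖ ≤ C) :
    ‖∫ᵛ x, f x ∂<•μ‖ ≤ C * μ.variation.real univ := by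
  have hC0 : 0 ≤ C := (norm_nonneg _).trans (hC 0)
  refine VectorMeasure.norm_integral_le_integral_norm.trans ?_
  have h2 : ∫ a, ‖f a‖ ∂μ.variation ≤ C * μ.variation.real univ := by
    calc ∫ a, ‖f a‖ ∂μ.variation ≤ ∫ a, C ∂μ.variation :=
          integral_mono_of_nonneg (Eventually.of_forall fun _ => norm_nonneg _)
            (integrable_const C) (Eventually.of_forall hC)
      _ = C * μ.variation.real univ := by rw [integral_const, smul_eq_mul, mul_comm]
  calc _ ≤ 1 * ∫ a, ‖f a‖ ∂μ.variation := by gcongr; exact norm_lsmul_flip_le F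
    _ ≤ _ := by rw [one_mul]; exact h2

lemma integrable_signed_of_bounded {F : Type} [NormedAddCommGroup F]
    (μ : SignedMeasure (E d)) {f : E d → F} (hf : AEStronglyMeasurable f μ.variation) {C : ℝ}
    (hC : ∀ x, ‖f x‖ ≤ C) : μ.Integrable f :=
  (integrable_const C).mono' hf (Eventually.of_forall hC)

lemma integral_signed_eq {F : Type} [NormedAddCommGroup F] [NormedSpace ℝ F] (P N : Measure (E d))
    [IsFiniteMeasure P] [IsFiniteMeasure N] {f : E d → F} (hP : Integrable f P)
    (hN : Integrable f N) :
    ∫ᵛ x, f x ∂<•(P.toSignedMeasure - N.toSignedMeasure) = ∫ x, f x ∂P - ∫ x, f x ∂N := by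
  rw [VectorMeasure.integral_sub_vectorMeasure, VectorMeasure.integral_toSignedMeasure,
    VectorMeasure.integral_toSignedMeasure]
  · rwa [VectorMeasure.Integrable, Measure.variation_toSignedMeasure]
  · rwa [VectorMeasure.Integrable, Measure.variation_toSignedMeasure]

lemma eq_posPart_sub_negPart (μ : SignedMeasure (E d)) :
    μ = μ.toJordanDecomposition.posPart.toSignedMeasure
      - μ.toJordanDecomposition.negPart.toSignedMeasure :=
  (SignedMeasure.toSignedMeasure_toJordanDecomposition μ).symm

lemma variation_eq (μ : SignedMeasure (E d)) : μ.variation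
    = μ.toJordanDecomposition.posPart + μ.toJordanDecomposition.negPart :=
  (SignedMeasure.totalVariation_eq_variation μ).symm

lemma integral_signed_ofReal (μ : SignedMeasure (E d)) (g : E d → ℝ) (hg : Continuous g) {C : ℝ}
    (hC : ∀ x, ‖g x‖ ≤ C) :
    ∫ᵛ x, ((g x : ℝ) : ℂ) ∂<•μ = ((∫ᵛ x, g x ∂<•μ : ℝ) : ℂ) := by
  have h : ∀ ν : Measure (E d), IsFiniteMeasure ν → Integrable g ν := fun ν _ =>
    (integrable_const C).mono' hg.aestronglyMeasurable (Eventually.of_forall hC)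
  rw [eq_posPart_sub_negPart μ, integral_signed_eq _ _ (h _ inferInstance) (h _ inferInstance),
    integral_signed_eq _ _ (h _ inferInstance).ofReal (h _ inferInstance).ofReal,
    integral_complex_ofReal, integral_complex_ofReal, Complex.ofReal_sub]

lemma integral_lsmul_eq (μ : SignedMeasure (E d)) (g : E d → ℝ) :
    ∫ᵛ x, g x ∂•μ = ∫ᵛ x, g x ∂<•μ := by
  have : (ContinuousLinearMap.lsmul ℝ ℝ : ℝ →L[ℝ] ℝ →L[ℝ] ℝ)
      = (ContinuousLinearMap.lsmul ℝ ℝ).flip := by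
    ext; simp
  rw [← this]

/-- The total variation is attained up to `ε` by test functions: approximate the sign of the
measure in `L¹` of its variation and clip the approximation. -/
lemma exists_variation_le_integral (μ : SignedMeasure (E d)) {ε : ℝ} (hε : 0 < ε) :
    ∃ g : E d → ℝ, Continuous g ∧ HasCompactSupport g ∧ (∀ x, |g x| ≤ 1) ∧
      μ.variation.real univ ≤ ∫ᵛ x, g x ∂<•μ + ε := by
  set P := μ.toJordanDecomposition.posPart with hP
  set N := μ.toJordanDecomposition.negPart with hN
  obtain ⟨A, hA, hPA, hNA⟩ := μ.toJordanDecomposition.mutuallySingular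
  let s : E d → ℝ := A.indicator (fun _ => -1) + Aᶜ.indicator fun _ => 1
  have hs : ∀ ν : Measure (E d), IsFiniteMeasure ν → Integrable s ν := fun ν _ =>
    ((integrable_const _).indicator hA).add ((integrable_const _).indicator hA.compl)
  have hs1 : ∀ x, |s x| ≤ 1 := by
    intro x
    by_cases hx : x ∈ A <;> simp [s, hx]
  obtain ⟨g0, hg0c, hg0, hg0k, hg0i⟩ :=
    (hs μ.variation inferInstance).exists_hasCompactSupport_integral_sub_le hε
  let g : E d → ℝ := fun x => max (-1) (min 1 (g0 x))
  have hg1 : ∀ x, |g x| ≤ 1 := fun x => abs_le.2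
    ⟨le_max_left _ _, max_le (by norm_num) (min_le_left _ _)⟩
  have hgc : Continuous g := by fun_prop
  have hgs : ∀ x, |s x - g x| ≤ ‖s x - g0 x‖ := by
    intro x
    have h1 := abs_le.1 (hs1 x)
    have e : s x = max (-1) (min 1 (s x)) := by rw [min_eq_right h1.2, max_eq_right h1.1]
    rw [Real.norm_eq_abs]
    conv_lhs => rw [e]
    refine (abs_max_sub_max_le_max _ _ _ _).trans ?_
    rw [sub_self, abs_zero, max_eq_right (abs_nonneg _)]
    refine (abs_min_sub_min_le_max _ _ _ _).trans ?_
    rw [sub_self, abs_zero, max_eq_right (abs_nonneg _)]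
  have hgi : ∀ ν : Measure (E d), IsFiniteMeasure ν → Integrable g ν := fun ν _ =>
    (integrable_const 1).mono' hgc.aestronglyMeasurable (Eventually.of_forall hg1)
  refine ⟨g, hgc, ?_, hg1, ?_⟩
  · exact hg0c.comp_left (g := fun y => max (-1) (min 1 y)) (by norm_num)
  have hsP : ∫ x, s x ∂P = P.real univ := by
    have : s =ᵐ[P] fun _ => 1 := by
      filter_upwards [compl_mem_ae_iff.2 hPA] with x hx
      have hx : x ∉ A := hx
      simp [s, hx]
    rw [integral_congr_ae this, integral_const, smul_eq_mul, mul_one]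
  have hsN : ∫ x, s x ∂N = -N.real univ := by
    have : s =ᵐ[N] fun _ => -1 := by
      filter_upwards [compl_mem_ae_iff.2 hNA] with x hx
      have hx : x ∈ A := not_not.1 hx
      simp [s, hx]
    rw [integral_congr_ae this, integral_const, smul_eq_mul, mul_neg_one]
  have hV : μ.variation.real univ = P.real univ + N.real univ := by
    rw [variation_eq]; exact measureReal_add_apply
  have hdi : ∀ ν : Measure (E d), IsFiniteMeasure ν → Integrable (fun x => s x - g x) ν :=
    fun ν h => (hs ν h).sub (hgi ν h)
  have hdist : ∫ x, |s x - g x| ∂P + ∫ x, |s x - g x| ∂N ≤ ε := by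
    rw [← integral_add_measure (hdi P inferInstance).abs (hdi N inferInstance).abs, ← variation_eq]
    refine (integral_mono (hdi _ inferInstance).abs ?_ hgs).trans hg0
    exact ((hs _ inferInstance).sub hg0i).norm
  have h1 := abs_integral_le_integral_abs (μ := P) (f := fun x => s x - g x)
  have h2 := abs_integral_le_integral_abs (μ := N) (f := fun x => s x - g x)
  rw [integral_sub (hs _ inferInstance) (hgi _ inferInstance)] at h1 h2
  rw [hsP] at h1
  rw [hsN] at h2
  have h3 : ∫ᵛ x, g x ∂<•μ = ∫ x, g x ∂P - ∫ x, g x ∂N := by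
    conv_lhs => rw [eq_posPart_sub_negPart μ]
    exact integral_signed_eq _ _ (hgi _ inferInstance) (hgi _ inferInstance)
  rw [h3, hV]
  linarith [(abs_le.1 h1).2, (abs_le.1 h2).1]

/-! ### The dual norm is the total variation -/

lemma normM_ofMeasure (hd : 0 < d) (μ : SignedMeasure (E d)) :
    normM (ofMeasure d μ) = μ.variation univ := by
  have hle : normM (ofMeasure d μ) ≤ μ.variation univ := by
    refine iSup_le fun φ => ?_
    rw [ofMeasure_apply, ← ofReal_norm, ← ofReal_measureReal]
    refine ENNReal.ofReal_le_ofReal ((norm_integral_signed_le μ φ.2).trans ?_)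
    rw [one_mul]
  refine le_antisymm hle ?_
  have hfin : normM (ofMeasure d μ) ≠ ⊤ := ne_top_of_le_ne_top (measure_ne_top _ _) hle
  rw [← ofReal_measureReal]
  refine ENNReal.ofReal_le_of_le_toReal ?_
  set N := (normM (ofMeasure d μ)).toReal with hN
  set V := μ.variation.real univ with hVdef
  have hN0 : 0 ≤ N := ENNReal.toReal_nonneg
  have hV0 : 0 ≤ V := measureReal_nonneg
  by_contra! hlt
  -- If `N < V`, an approximation of the sign of `μ` with small enough error `δ` gives a contradiction.
  obtain ⟨δ, hδ, hδ'⟩ : ∃ δ > 0, δ * (1 + V + N) < V - N :=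
    ⟨(V - N) / (2 * (1 + V + N)), div_pos (by linarith) (by positivity), by
      rw [div_mul_eq_mul_div, div_lt_iff₀ (by positivity)]
      have : 0 < (V - N) * (1 + V + N) := mul_pos (by linarith) (by positivity)
      linarith⟩
  obtain ⟨g, hgc, hgs, hg1, hgV⟩ := exists_variation_le_integral μ hδ
  let G : ZeroAtInftyContinuousMap (E d) ℂ :=
    ⟨⟨fun x => (g x : ℂ), by fun_prop⟩,
      (hgs.comp_left (g := fun y : ℝ => (y : ℂ)) Complex.ofReal_zero).is_zero_at_infty⟩
  obtain ⟨ψ, hψ⟩ := exists_lizorkin_dist_le hd G hδ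
  have hGx : ∀ x, G x = (g x : ℂ) := fun x => rfl
  simp only [hGx] at hψ
  have hψ1 : ∀ x, ‖ψ.1 x‖ ≤ 1 + δ := by
    intro x
    have h1 := norm_le_norm_add_norm_sub (g x : ℂ) (ψ.1 x)
    rw [norm_sub_rev] at h1
    have h2 : ‖(g x : ℂ)‖ ≤ 1 := by rw [Complex.norm_real]; exact hg1 x
    linarith [hψ x]
  -- The rescaled test function is admissible in the definition of the dual norm.
  have hadm : ‖∫ᵛ x, ψ.1 x ∂<•μ‖ ≤ (1 + δ) * N := by
    have hx : ∀ x, ‖(((((1 + δ)⁻¹ : ℝ) : ℂ) • ψ : Lizorkin d).1 x)‖ ≤ 1 := by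
      intro x
      change ‖(((1 + δ)⁻¹ : ℝ) : ℂ) • ψ.1 x‖ ≤ 1
      rw [norm_smul, Complex.norm_real, Real.norm_of_nonneg (by positivity), inv_mul_le_one₀
        (by positivity)]
      exact hψ1 x
    have h1 : ‖ofMeasure d μ ((((1 + δ)⁻¹ : ℝ) : ℂ) • ψ)‖ₑ ≤ normM (ofMeasure d μ) :=
      le_iSup (fun φ : {φ : Lizorkin d // ∀ x, ‖φ.1 x‖ ≤ 1} => ‖ofMeasure d μ φ.1‖ₑ)
        ⟨(((1 + δ)⁻¹ : ℝ) : ℂ) • ψ, hx⟩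
    have h2 := ENNReal.toReal_mono hfin h1
    rw [toReal_enorm, map_smul, norm_smul, Complex.norm_real, Real.norm_of_nonneg (by positivity),
      inv_mul_le_iff₀ (by positivity)] at h2
    exact h2
  have hdiff : ‖∫ᵛ x, (g x : ℂ) ∂<•μ - ∫ᵛ x, ψ.1 x ∂<•μ‖ ≤ δ * V := by
    rw [← VectorMeasure.integral_fun_sub]
    · refine norm_integral_signed_le μ fun x => ?_
      rw [norm_sub_rev]; exact hψ x
    · exact integrable_signed_of_bounded μ (by fun_prop) (C := 1) fun x => by
        rw [Complex.norm_real]; exact hg1 x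
    · exact integrable_signed_of_bounded μ ψ.1.continuous.aestronglyMeasurable hψ1
  rw [integral_signed_ofReal μ g hgc hg1] at hdiff
  have h4 := norm_le_norm_add_norm_sub (∫ᵛ x, ψ.1 x ∂<•μ) (((∫ᵛ x, g x ∂<•μ : ℝ)) : ℂ)
  rw [Complex.norm_real, norm_sub_rev] at h4
  have h5 := Real.le_norm_self (∫ᵛ x, g x ∂<•μ)
  linarith

lemma ofMeasure_injective (hd : 0 < d) : Function.Injective (ofMeasure d) := by
  rw [injective_iff_map_eq_zero]
  intro μ hμ
  have h := normM_ofMeasure hd μ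
  rw [hμ] at h
  have h0 : normM (0 : LizorkinDist d) = 0 := by simp [normM]
  rw [h0] at h
  have hv : μ.variation = 0 := Measure.measure_univ_eq_zero.1 h.symm
  ext s hs
  have := μ.norm_measure_le_variation (E := s)
  rw [hv] at this
  simpa using this

variable {α : ℝ}

/-! ### Native space and signed measures -/

lemma fracLap_fracLap_of_add_eq_zero {s t : ℝ} (hst : s + t = 0) (φ : Lizorkin d) :
    fracLap d s (fracLap d t φ) = φ := by
  apply Subtype.ext
  have h : 𝓕 (fracLap d s (fracLap d t φ)).1 = 𝓕 φ.1 := by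
    ext ξ
    rw [fourier_fracLap, fourier_fracLap, smul_smul]
    rcases eq_or_ne ξ 0 with rfl | hξ
    · have h0 : 𝓕 φ.1 0 = 0 := IsFlat.zero ((mem_lizorkin_iff φ.1).1 φ.2)
      rw [h0, smul_zero]
    · have hpos : 0 < 2 * Real.pi * ‖ξ‖ := by
        have := norm_pos_iff.2 hξ
        have := Real.pi_pos
        positivity
      rw [← Real.rpow_add hpos, hst, Real.rpow_zero, one_smul]
  have h2 := congrArg (fun f : 𝓢(E d, ℂ) => 𝓕⁻ f) h
  simpa using h2

lemma fracLapDist_fracLapDist_of_add_eq_zero {s t : ℝ} (hst : s + t = 0) (f : LizorkinDist d) :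
    fracLapDist d s (fracLapDist d t f) = f := by
  ext φ
  change f (fracLap d t (fracLap d s φ)) = f φ
  rw [fracLap_fracLap_of_add_eq_zero (by linarith)]

/-- The linear isomorphism `μ ↦ (-Δ)^(-α/2) μ` from the finite signed measures onto the native
space. -/
noncomputable def ofSigned (hd : 0 < d) (α : ℝ) : SignedMeasure (E d) ≃ₗ[ℝ] NativeSpace d α :=
  LinearEquiv.ofInjective ((fracLapDist d (-α)).restrictScalars ℝ ∘ₗ ofMeasure d) <| by
    intro μ ν h
    refine ofMeasure_injective hd ?_
    have h2 := congrArg (fracLapDist d α) h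
    rwa [LinearMap.comp_apply, LinearMap.comp_apply, LinearMap.restrictScalars_apply,
      LinearMap.restrictScalars_apply, fracLapDist_fracLapDist_of_add_eq_zero (by ring),
      fracLapDist_fracLapDist_of_add_eq_zero (by ring)] at h2

lemma toDist_injective : Function.Injective (NativeSpace.toDist (d := d) (α := α)) :=
  Subtype.val_injective

lemma ofSigned_measure (hd : 0 < d) (f : NativeSpace d α) : ofSigned hd α f.measure = f :=
  toDist_injective f.measure_spec

lemma measure_eq (hd : 0 < d) (f : NativeSpace d α) : f.measure = (ofSigned hd α).symm f := by
  rw [LinearEquiv.eq_symm_apply, ofSigned_measure]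

lemma measure_ofSigned (hd : 0 < d) (μ : SignedMeasure (E d)) :
    (ofSigned hd α μ).measure = μ := by
  rw [measure_eq hd, LinearEquiv.symm_apply_apply]

lemma normM_fracLapDist_toDist (hd : 0 < d) (f : NativeSpace d α) :
    normM (fracLapDist d α f.toDist) = f.measure.variation univ := by
  rw [← f.measure_spec, fracLapDist_fracLapDist_of_add_eq_zero (by ring), normM_ofMeasure hd]

/-! ### The predual as a space of continuous functions -/

/-- The function `(-Δ)^(-α/2) φ`, as an element of the space of continuous functions that vanish
at infinity. -/
noncomputable def coreToC0 (φ : PredualCore d α) : ZeroAtInftyContinuousMap (E d) ℂ :=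
  (fracLap d (-α) φ).1.toZeroAtInfty

lemma isometry_coreToC0 : Isometry (coreToC0 (d := d) (α := α)) := by
  refine Isometry.of_dist_eq fun φ ψ => ?_
  rw [← ZeroAtInftyContinuousMap.dist_toBCF_eq_dist]
  rfl

/-- The identification of the predual with the space of continuous functions that vanish at
infinity. -/
noncomputable def predualToC0 : Predual d α → ZeroAtInftyContinuousMap (E d) ℂ :=
  UniformSpace.Completion.extension coreToC0

lemma isometry_predualToC0 : Isometry (predualToC0 (d := d) (α := α)) :=
  isometry_coreToC0.completion_extension

lemma predualToC0_coe (φ : PredualCore d α) : predualToC0 (φ : Predual d α) = coreToC0 φ :=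
  UniformSpace.Completion.extension_coe isometry_coreToC0.uniformContinuous φ

/-- An isometric image of a complete space is closed, so density of the Lizorkin space suffices. -/
lemma predualToC0_surjective (hd : 0 < d) :
    Function.Surjective (predualToC0 (d := d) (α := α)) := by
  have hcl : IsClosed (range (predualToC0 (d := d) (α := α))) :=
    isometry_predualToC0.isClosedEmbedding.isClosed_range
  intro g
  rw [← mem_range, ← hcl.closure_eq, Metric.mem_closure_iff]
  intro ε hε
  obtain ⟨ψ, hψ⟩ := exists_lizorkin_dist_le hd g (half_pos hε)
  let φ : PredualCore d α := fracLap d α ψ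
  refine ⟨_, ⟨(φ : Predual d α), rfl⟩, ?_⟩
  rw [predualToC0_coe, ← ZeroAtInftyContinuousMap.dist_toBCF_eq_dist]
  refine lt_of_le_of_lt ((BoundedContinuousFunction.dist_le (half_pos hε).le).2 fun x => ?_)
    (half_lt_self hε)
  rw [dist_comm, dist_eq_norm]
  have e : coreToC0 φ x = ψ.1 x := by
    change (fracLap d (-α) (fracLap d α ψ)).1 x = ψ.1 x
    rw [fracLap_fracLap_of_add_eq_zero (by ring)]
  exact (congrArg (fun z => ‖z - g x‖) e).le.trans (hψ x)

lemma pairing_eq (f : NativeSpace d α) (u : Predual d α) :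
    pairing f u = ∫ᵛ x, predualToC0 u x ∂<•f.measure := by
  change _ = integralBCF f.measure (predualToC0 u).toBCF
  induction u using UniformSpace.Completion.induction_on with
  | hp =>
    refine isClosed_eq UniformSpace.Completion.continuous_extension ?_
    exact (integralBCF f.measure).continuous.comp
      (ZeroAtInftyContinuousMap.isometry_toBCF.continuous.comp isometry_predualToC0.continuous)
  | ih φ =>
    rw [pairing_coe, predualToC0_coe]
    exact (congrArg (fun g : LizorkinDist d => g φ) f.measure_spec).symm

/-- The total variation norm of `(-Δ)^(α/2) f`. -/
noncomputable def tvNorm (f : NativeSpace d α) : ℝ := f.measure.variation.real univ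

lemma tvNorm_eq (hd : 0 < d) (f : NativeSpace d α) :
    (normM (fracLapDist d α f.toDist)).toReal = tvNorm f := by
  rw [normM_fracLapDist_toDist hd]; rfl

lemma tvNorm_add_le (hd : 0 < d) (f g : NativeSpace d α) :
    tvNorm (f + g) ≤ tvNorm f + tvNorm g := by
  unfold tvNorm
  rw [measure_eq hd, map_add, ← measure_eq, ← measure_eq, ← measureReal_add_apply]
  exact ENNReal.toReal_mono (measure_ne_top _ _) (VectorMeasure.variation_add_le univ)

lemma tvNorm_smul (hd : 0 < d) (c : ℝ) (f : NativeSpace d α) :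
    tvNorm (c • f) = |c| * tvNorm f := by
  unfold tvNorm
  rw [measure_eq hd, map_smul, ← measure_eq, VectorMeasure.variation_smul]
  simp [measureReal_def]

/-! ### The weak* topology -/

lemma pairing_add (hd : 0 < d) (f g : NativeSpace d α) (u : Predual d α) :
    pairing (f + g) u = pairing f u + pairing g u := by
  simp only [pairing_eq]
  rw [measure_eq hd, map_add, ← measure_eq, ← measure_eq]
  exact VectorMeasure.integral_add_vectorMeasure
    (integrable_signed _ (predualToC0 u).toBCF) (integrable_signed _ (predualToC0 u).toBCF)

lemma pairing_smul (hd : 0 < d) (c : ℝ) (f : NativeSpace d α) (u : Predual d α) :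
    pairing (c • f) u = c • pairing f u := by
  simp only [pairing_eq]
  rw [measure_eq hd, map_smul, ← measure_eq]
  exact VectorMeasure.integral_smul_vectorMeasure _ c

/-- The duality pairing as a linear map into the functions on the predual. -/
noncomputable def pairingLM (hd : 0 < d) (α : ℝ) : NativeSpace d α →ₗ[ℝ] (Predual d α → ℂ) where
  toFun := pairing
  map_add' f g := by ext1 u; exact pairing_add hd f g u
  map_smul' c f := by ext1 u; exact pairing_smul hd c f u

/-- The weak* topology is induced by a linear map into a product, which makes it a locally convex
vector space topology. -/
lemma topology_eq_induced (hd : 0 < d) :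
    (inferInstance : TopologicalSpace (NativeSpace d α))
      = TopologicalSpace.induced (pairingLM hd α) inferInstance := by
  rw [induced_to_pi]
  rfl

lemma continuous_pairing (u : Predual d α) : Continuous fun f : NativeSpace d α => pairing f u :=
  continuous_iff_le_induced.2 (iInf_le _ u)

lemma continuous_nativeSpace_iff {X : Type} [TopologicalSpace X] (h : X → NativeSpace d α) :
    Continuous h ↔ ∀ u : Predual d α, Continuous fun x => pairing (h x) u := by
  rw [continuous_iInf_rng]
  exact forall_congr' fun u => continuous_induced_rng

lemma isTopologicalAddGroup_nativeSpace (hd : 0 < d) : IsTopologicalAddGroup (NativeSpace d α) := by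
  have h := topologicalAddGroup_induced (pairingLM hd α)
  rwa [← topology_eq_induced] at h

lemma continuousSMul_nativeSpace (hd : 0 < d) : ContinuousSMul ℝ (NativeSpace d α) := by
  have h := continuousSMul_induced (R := ℝ) (pairingLM hd α)
  rwa [← topology_eq_induced] at h

lemma locallyConvexSpace_nativeSpace (hd : 0 < d) : LocallyConvexSpace ℝ (NativeSpace d α) := by
  have h := LocallyConvexSpace.induced (pairingLM hd α)
  rwa [← topology_eq_induced] at h

lemma t2Space_nativeSpace (hd : 0 < d) : T2Space (NativeSpace d α) := by
  refine T2Space.of_injective_continuous (f := pairingLM hd α) (fun f g h => ?_)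
    (continuous_pi continuous_pairing)
  refine toDist_injective ?_
  ext φ
  let φ' : PredualCore d α := φ
  have := congrFun h (φ' : Predual d α)
  change pairing f _ = pairing g _ at this
  rw [pairing_coe, pairing_coe] at this
  exact this

/-- Integration of a continuous function that vanishes at infinity is weak* continuous. -/
lemma continuous_integral_measure (hd : 0 < d) {g : E d → ℝ} (hg : Continuous g)
    (hg0 : Tendsto g (cocompact (E d)) (𝓝 0)) :
    Continuous fun f : NativeSpace d α => ∫ᵛ x, g x ∂<•f.measure := by
  let g0 : ZeroAtInftyContinuousMap (E d) ℝ := ⟨⟨g, hg⟩, hg0⟩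
  let G : ZeroAtInftyContinuousMap (E d) ℂ :=
    ⟨⟨fun x => (g x : ℂ), by fun_prop⟩, by
      have := (Complex.continuous_ofReal.tendsto 0).comp hg0
      simpa [Function.comp_def] using this⟩
  obtain ⟨u, hu⟩ := predualToC0_surjective (α := α) hd G
  have h := Complex.continuous_re.comp (continuous_pairing u)
  convert h using 1
  ext1 f
  have hb := g0.toBCF.norm_coe_le_norm
  have e : ∫ᵛ x, predualToC0 u x ∂<•f.measure = ∫ᵛ x, ((g x : ℝ) : ℂ) ∂<•f.measure := by
    rw [hu]; rfl
  rw [Function.comp_apply, pairing_eq, e, integral_signed_ofReal f.measure g hg hb,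
    Complex.ofReal_re]

/-! ### Weak* compactness -/

/-- The extension by zero of a continuous function that vanishes at infinity to the one-point
compactification. -/
noncomputable def extendOnePoint (g : ZeroAtInftyContinuousMap (E d) ℂ) :
    BoundedContinuousFunction (OnePoint (E d)) ℂ :=
  BoundedContinuousFunction.mkOfCompact
    (OnePoint.continuousMapMk g.toContinuousMap 0 (by
      rw [coclosedCompact_eq_cocompact]; exact g.zero_at_infty'))

lemma integral_comap_coe [MeasurableSpace (OnePoint (E d))] [BorelSpace (OnePoint (E d))]
    (P : Measure (OnePoint (E d))) (g : ZeroAtInftyContinuousMap (E d) ℂ) :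
    ∫ x, g x ∂(P.comap ((↑) : E d → OnePoint (E d))) = ∫ x, extendOnePoint g x ∂P := by
  have hemb : MeasurableEmbedding ((↑) : E d → OnePoint (E d)) :=
    OnePoint.isOpenEmbedding_coe.measurableEmbedding
  have h1 : ∫ x, g x ∂(P.comap ((↑) : E d → OnePoint (E d)))
      = ∫ x : E d, extendOnePoint g (x : OnePoint (E d)) ∂(P.comap OnePoint.some) := rfl
  rw [h1, ← hemb.integral_map, hemb.map_comap]
  refine setIntegral_eq_integral_of_forall_compl_eq_zero fun x hx => ?_
  have : x = OnePoint.infty := by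
    rw [← mem_compl_iff, OnePoint.compl_range_coe] at hx
    exact hx
  rw [this]
  rfl

lemma continuous_integral_finiteMeasure {X : Type} [TopologicalSpace X] [MeasurableSpace X]
    [OpensMeasurableSpace X] (f : BoundedContinuousFunction X ℂ) :
    Continuous fun P : FiniteMeasure X => ∫ x, f x ∂(P : Measure X) := by
  have hre := FiniteMeasure.continuous_integral_boundedContinuousFunction
    (BoundedContinuousFunction.comp _ Complex.reCLM.lipschitz f)
  have him := FiniteMeasure.continuous_integral_boundedContinuousFunction
    (BoundedContinuousFunction.comp _ Complex.imCLM.lipschitz f)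
  have e : ∀ P : FiniteMeasure X, ∫ x, f x ∂(P : Measure X)
      = ((∫ x, (f x).re ∂(P : Measure X) : ℝ) : ℂ)
        + ((∫ x, (f x).im ∂(P : Measure X) : ℝ) : ℂ) * Complex.I := fun P =>
    (integral_re_add_im (𝕜 := ℂ) (f.integrable _)).symm
  simp only [e]
  exact (Complex.continuous_ofReal.comp hre).add
    ((Complex.continuous_ofReal.comp him).mul continuous_const)

/-- Balls of the total variation norm are contained in weak* compact sets. The bound on the mass
makes the positive and negative parts range over compact sets of measures on the one-point
compactification. -/
lemma exists_isCompact_superset_tvNorm_le (hd : 0 < d) (C : ℝ) :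
    ∃ K : Set (NativeSpace d α), IsCompact K ∧ {f | tvNorm f ≤ C} ⊆ K := by
  let _ : MeasurableSpace (OnePoint (E d)) := borel _
  have _ : BorelSpace (OnePoint (E d)) := ⟨rfl⟩
  have hemb : MeasurableEmbedding ((↑) : E d → OnePoint (E d)) :=
    OnePoint.isOpenEmbedding_coe.measurableEmbedding
  let Φ : FiniteMeasure (OnePoint (E d)) × FiniteMeasure (OnePoint (E d)) → NativeSpace d α :=
    fun p => ofSigned hd α
      (((p.1 : Measure (OnePoint (E d))).comap OnePoint.some).toSignedMeasure
        - ((p.2 : Measure (OnePoint (E d))).comap OnePoint.some).toSignedMeasure)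
  have hΦ : Continuous Φ := by
    rw [continuous_nativeSpace_iff]
    intro u
    have e : ∀ p, pairing (Φ p) u
        = ∫ x, extendOnePoint (predualToC0 u) x ∂(p.1 : Measure (OnePoint (E d)))
          - ∫ x, extendOnePoint (predualToC0 u) x ∂(p.2 : Measure (OnePoint (E d))) := by
      intro p
      rw [pairing_eq, measure_ofSigned hd, integral_signed_eq, integral_comap_coe,
        integral_comap_coe]
      · exact (predualToC0 u).toBCF.integrable _
      · exact (predualToC0 u).toBCF.integrable _
    simp only [e]
    exact ((continuous_integral_finiteMeasure _).comp continuous_fst).sub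
      ((continuous_integral_finiteMeasure _).comp continuous_snd)
  have hK := isCompact_setOfPred_finiteMeasure_le_of_compactSpace (OnePoint (E d)) C.toNNReal
  refine ⟨Φ '' _, (hK.prod hK).image hΦ, fun f hf => ?_⟩
  set P := f.measure.toJordanDecomposition.posPart with hP
  set N := f.measure.toJordanDecomposition.negPart with hN
  have hmass : P.real univ + N.real univ ≤ C := by
    have h1 : f.measure.variation.real univ = P.real univ + N.real univ := by
      rw [variation_eq]; exact measureReal_add_apply
    rw [← h1]; exact hf
  have hb : ∀ ν : Measure (E d), (hν : IsFiniteMeasure ν) → ν.real univ ≤ C →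
      FiniteMeasure.mass (⟨ν.map OnePoint.some, inferInstance⟩ : FiniteMeasure (OnePoint (E d)))
        ≤ C.toNNReal := by
    intro ν hν h
    refine NNReal.le_toNNReal_of_coe_le ?_
    have : ((FiniteMeasure.mass
        (⟨ν.map OnePoint.some, inferInstance⟩ : FiniteMeasure (OnePoint (E d)))) : ℝ)
        = ν.real univ := by
      change (ν.map OnePoint.some).real univ = _
      rw [measureReal_def, measureReal_def, hemb.map_apply, preimage_univ]
    rw [this]; exact h
  have hP0 : 0 ≤ P.real univ := measureReal_nonneg
  have hN0 : 0 ≤ N.real univ := measureReal_nonneg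
  refine ⟨(⟨P.map OnePoint.some, inferInstance⟩, ⟨N.map OnePoint.some, inferInstance⟩),
    ⟨hb P inferInstance (by linarith), hb N inferInstance (by linarith)⟩, ?_⟩
  refine Eq.trans ?_ (ofSigned_measure hd f)
  change ofSigned hd α (((P.map OnePoint.some).comap OnePoint.some).toSignedMeasure
    - ((N.map OnePoint.some).comap OnePoint.some).toSignedMeasure) = _
  congr 1
  conv_rhs => rw [eq_posPart_sub_negPart f.measure]
  rw [Measure.toSignedMeasure_congr (hemb.comap_map P),
    Measure.toSignedMeasure_congr (hemb.comap_map N)]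

/-- The total variation norm is a supremum of weak* continuous functionals. -/
lemma lowerSemicontinuous_tvNorm (hd : 0 < d) :
    LowerSemicontinuous (tvNorm : NativeSpace d α → ℝ) := by
  rw [lowerSemicontinuous_iff_isClosed_preimage]
  intro c
  have e : tvNorm ⁻¹' Iic c = ⋂ g ∈ {g : E d → ℝ | Continuous g ∧ HasCompactSupport g ∧
      ∀ x, |g x| ≤ 1}, {f : NativeSpace d α | ∫ᵛ x, g x ∂<•f.measure ≤ c} := by
    ext f
    simp only [mem_preimage, mem_Iic, mem_iInter, mem_ofPred_eq]
    constructor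
    · rintro hf g ⟨-, -, hg⟩
      have := norm_integral_signed_le f.measure (f := g) (C := 1) hg
      rw [one_mul] at this
      exact (Real.le_norm_self _).trans (this.trans hf)
    · intro h
      refine le_of_forall_pos_le_add fun ε hε => ?_
      obtain ⟨g, hg1, hg2, hg3, hg4⟩ := exists_variation_le_integral f.measure hε
      exact hg4.trans (by linarith [h g ⟨hg1, hg2, hg3⟩])
  rw [e]
  refine isClosed_biInter fun g hg => ?_
  exact isClosed_le (continuous_integral_measure hd hg.1 hg.2.1.is_zero_at_infty) continuous_const

/-! ### Existence of minimizers -/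

/-- The direct method: as `D` is bounded below, the sublevel sets of `D + lam * N` lie in sublevel
sets of `N`, and by lower semicontinuity they are compact. -/
lemma exists_minimizer_and_isCompact {V : Type} [TopologicalSpace V] [T2Space V] [Inhabited V]
    {N : V → ℝ} (hN : LowerSemicontinuous N)
    (hcomp : ∀ C, ∃ K : Set V, IsCompact K ∧ {f | N f ≤ C} ⊆ K) {D : V → ℝ} (hD : Continuous D)
    {b : ℝ} (hb : ∀ f, b ≤ D f) {lam : ℝ} (hlam : 0 < lam) :
    {f | ∀ g, D f + lam * N f ≤ D g + lam * N g}.Nonempty ∧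
      IsCompact {f | ∀ g, D f + lam * N f ≤ D g + lam * N g} := by
  set J : V → ℝ := fun f => D f + lam * N f with hJ
  have hlsc : LowerSemicontinuous J := by
    refine hD.lowerSemicontinuous.add ?_
    exact (continuous_const.mul continuous_id).comp_lowerSemicontinuous hN
      (fun a b h => mul_le_mul_of_nonneg_left h hlam.le)
  have hsub : ∀ c, IsCompact {f | J f ≤ c} := by
    intro c
    obtain ⟨K, hK, hKs⟩ := hcomp ((c - b) / lam)
    refine hK.of_isClosed_subset (lowerSemicontinuous_iff_isClosed_preimage.1 hlsc c) fun f hf => ?_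
    refine hKs ?_
    have hf : D f + lam * N f ≤ c := hf
    have := hb f
    change N f ≤ (c - b) / lam
    rw [le_div_iff₀ hlam]
    linarith
  obtain ⟨f0, hf0, hmin⟩ := (hlsc.lowerSemicontinuousOn _).exists_isMinOn
    (s := {f | J f ≤ J default}) ⟨default, le_refl (J default)⟩ (hsub _)
  have hglob : ∀ g, J f0 ≤ J g := by
    intro g
    by_cases hg : J g ≤ J default
    · exact hmin hg
    · exact le_trans hf0 (le_of_not_ge hg)
  refine ⟨⟨f0, hglob⟩, ?_⟩
  convert hsub (J f0) using 1
  ext f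
  exact ⟨fun h => h f0, fun h g => le_trans h (hglob g)⟩

/-! ### The representation operator and the objective -/

lemma exists_norm_kernel_le (hα : (d : ℝ) < α) (hαd : ∀ n : ℕ, α - d ≠ n) {χ : ℝ → ℝ}
    (hχ : Continuous χ) (hχ0 : ∀ t, |t| ≤ 1 → χ t = 0) (hχ1 : ∀ t, 2 ≤ |t| → χ t = 1) (z : E d) :
    ∃ C, ∀ y, ‖kernel d α χ z y‖ ≤ C := by
  let g : ZeroAtInftyContinuousMap (E d) ℝ :=
    ⟨⟨kernel d α χ z, continuous_kernel hα hχ hχ0 z⟩, tendsto_kernel hαd hχ1 z⟩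
  exact ⟨‖g.toBCF‖, fun y => g.toBCF.norm_coe_le_norm y⟩

lemma integrable_kernel (hα : (d : ℝ) < α) (hαd : ∀ n : ℕ, α - d ≠ n) {χ : ℝ → ℝ}
    (hχ : Continuous χ) (hχ0 : ∀ t, |t| ≤ 1 → χ t = 0) (hχ1 : ∀ t, 2 ≤ |t| → χ t = 1)
    (μ : SignedMeasure (E d)) (z : E d) : μ.Integrable (kernel d α χ z) := by
  obtain ⟨C, hC⟩ := exists_norm_kernel_le hα hαd hχ hχ0 hχ1 z
  exact integrable_signed_of_bounded μ (continuous_kernel hα hχ hχ0 z).aestronglyMeasurable hC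

/-- Point evaluation of the representation operator, as a linear functional of the measure. -/
noncomputable def representLM (hα : (d : ℝ) < α) (hαd : ∀ n : ℕ, α - d ≠ n) {χ : ℝ → ℝ}
    (hχ : Continuous χ) (hχ0 : ∀ t, |t| ≤ 1 → χ t = 0) (hχ1 : ∀ t, 2 ≤ |t| → χ t = 1) (z : E d) :
    SignedMeasure (E d) →ₗ[ℝ] ℝ where
  toFun μ := ∫ᵛ y, kernel d α χ z y ∂<•μ
  map_add' μ ν := VectorMeasure.integral_add_vectorMeasure
    (integrable_kernel hα hαd hχ hχ0 hχ1 μ z) (integrable_kernel hα hαd hχ hχ0 hχ1 ν z)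
  map_smul' c _ := VectorMeasure.integral_smul_vectorMeasure _ c

/-- Point evaluation `f ↦ P f (z)` is a weak* continuous linear functional on the native space. -/
lemma exists_linearMap_represent (hd : 0 < d) (hα : (d : ℝ) < α) (hαd : ∀ n : ℕ, α - d ≠ n)
    {χ : ℝ → ℝ} (hχ : Continuous χ) (hχ0 : ∀ t, |t| ≤ 1 → χ t = 0)
    (hχ1 : ∀ t, 2 ≤ |t| → χ t = 1) (z : E d) :
    ∃ P : NativeSpace d α →ₗ[ℝ] ℝ, (∀ f, P f = represent χ f z) ∧ Continuous P ∧
      ∀ c, P (ofSigned hd α (VectorMeasure.dirac c 1)) = kernel d α χ z c := by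
  have h : ∀ f : NativeSpace d α, (representLM hα hαd hχ hχ0 hχ1 z ∘ₗ
      (ofSigned hd α).symm.toLinearMap) f = ∫ᵛ y, kernel d α χ z y ∂<•f.measure := fun f => by
    rw [measure_eq hd]; rfl
  refine ⟨representLM hα hαd hχ hχ0 hχ1 z ∘ₗ (ofSigned hd α).symm.toLinearMap,
    fun f => ?_, ?_, fun c => ?_⟩
  · rw [h, represent, integral_lsmul_eq]
  · rw [show ⇑(representLM hα hαd hχ hχ0 hχ1 z ∘ₗ (ofSigned hd α).symm.toLinearMap)
      = fun f : NativeSpace d α => ∫ᵛ y, kernel d α χ z y ∂<•f.measure from funext h]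
    exact continuous_integral_measure hd (continuous_kernel hα hχ hχ0 z) (tendsto_kernel hαd hχ1 z)
  · rw [h, measure_ofSigned, VectorMeasure.integral_dirac]
    simp

lemma tvNorm_sum_smul_le (hd : 0 < d) {ι : Type} (s : Finset ι) (c : ι → ℝ)
    (f : ι → NativeSpace d α) :
    tvNorm (∑ i ∈ s, c i • f i) ≤ ∑ i ∈ s, |c i| * tvNorm (f i) := by
  classical
  induction s using Finset.induction_on with
  | empty => simpa using (tvNorm_smul hd 0 (0 : NativeSpace d α)).le
  | insert i s hi ih =>
    rw [Finset.sum_insert hi, Finset.sum_insert hi, ← tvNorm_smul hd]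
    exact (tvNorm_add_le hd _ _).trans (by gcongr)

lemma convexOn_tvNorm (hd : 0 < d) : ConvexOn ℝ univ (tvNorm (d := d) (α := α)) := by
  refine ⟨convex_univ, fun f _ g _ a b ha hb _ => (tvNorm_add_le hd _ _).trans (le_of_eq ?_)⟩
  rw [tvNorm_smul hd, tvNorm_smul hd, abs_of_nonneg ha, abs_of_nonneg hb, smul_eq_mul, smul_eq_mul]

lemma tvNorm_ofSigned_restrict (hd : 0 < d) (μ : SignedMeasure (E d)) {s : Set (E d)}
    (hs : MeasurableSet s) :
    tvNorm (ofSigned hd α (μ.restrict s)) = μ.variation.real s := by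
  rw [tvNorm, measure_ofSigned, VectorMeasure.variation_restrict hs,
    measureReal_restrict_apply MeasurableSet.univ, univ_inter]

/-! ### Extreme points of a solution set -/

lemma eq_restrict_compl_add_sum_restrict {ι : Type} [Fintype ι] (μ : SignedMeasure (E d))
    {U : ι → Set (E d)} (hU : ∀ i, MeasurableSet (U i)) (hdisj : Pairwise (Function.onFun Disjoint U)) :
    μ = μ.restrict (⋃ i, U i)ᶜ + ∑ i, μ.restrict (U i) := by
  have hm : MeasurableSet (⋃ i, U i) := MeasurableSet.iUnion hU
  ext s hs
  rw [add_apply, FunLike.coe_sum, Finset.sum_apply,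
    VectorMeasure.restrict_apply _ hm.compl hs]
  have h1 : ∑ i, μ.restrict (U i) s = μ (s ∩ ⋃ i, U i) := by
    rw [inter_iUnion, VectorMeasure.of_disjoint_iUnion (fun i => hs.inter (hU i))
      (fun i j hij => (hdisj hij).mono inter_subset_right inter_subset_right), tsum_fintype]
    exact Finset.sum_congr rfl fun i _ => VectorMeasure.restrict_apply _ (hU i) hs
  rw [h1, ← VectorMeasure.of_union (disjoint_compl_left.mono inter_subset_right inter_subset_right)
    (hs.inter hm.compl) (hs.inter hm), ← inter_union_distrib_left, compl_union_self, inter_univ]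

/-- The measure of an extreme minimizer cannot charge `M + 1` disjoint sets: some nonzero
combination of its restrictions to these sets is invisible to the `M` measurements, and both of the
perturbations by it are again minimizers. -/
lemma not_extreme_of_disjoint (hd : 0 < d) {M : ℕ} (P : Fin M → NativeSpace d α →ₗ[ℝ] ℝ)
    (D : (Fin M → ℝ) → ℝ) {lam : ℝ} (hlam : 0 < lam) {f : NativeSpace d α}
    (hf : f ∈ extremePoints ℝ {f : NativeSpace d α | ∀ g : NativeSpace d α,
      D (fun m => P m f) + lam * tvNorm f ≤ D (fun m => P m g) + lam * tvNorm g})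
    {U : Fin (M + 1) → Set (E d)} (hU : ∀ i, MeasurableSet (U i))
    (hdisj : Pairwise (Function.onFun Disjoint U)) (hpos : ∀ i, f.measure.variation (U i) ≠ 0) : False := by
  set μ := f.measure with hμ
  let ν : Fin (M + 1) → NativeSpace d α := fun i => ofSigned hd α (μ.restrict (U i))
  let T : (Fin (M + 1) → ℝ) →ₗ[ℝ] (Fin M → ℝ) :=
    LinearMap.pi fun m => P m ∘ₗ Fintype.linearCombination ℝ ν
  obtain ⟨t, ht, ht0⟩ := (Submodule.ne_bot_iff _).1
    (LinearMap.ker_ne_bot_of_finrank_lt (f := T) (by simp))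
  -- Normalize the coefficients so that `1 ± tᵢ ≥ 0`.
  obtain ⟨t, ht, ht0, ht1⟩ : ∃ t, T t = 0 ∧ t ≠ 0 ∧ ∀ i, |t i| ≤ 1 := by
    have hn : ‖t‖ ≠ 0 := norm_ne_zero_iff.2 ht0
    refine ⟨‖t‖⁻¹ • t, by rw [map_smul, LinearMap.mem_ker.1 ht, smul_zero],
      smul_ne_zero (inv_ne_zero hn) ht0, fun i => ?_⟩
    have h1 : ‖‖t‖⁻¹ • t‖ = 1 := by
      rw [norm_smul, norm_inv, norm_norm, inv_mul_cancel₀ hn]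
    exact h1 ▸ norm_le_pi_norm (‖t‖⁻¹ • t) i
  have hdecomp : f = ofSigned hd α (μ.restrict (⋃ i, U i)ᶜ) + ∑ i, ν i := by
    rw [← map_sum, ← map_add, ← eq_restrict_compl_add_sum_restrict μ hU hdisj, hμ,
      ofSigned_measure]
  have hN : tvNorm f = tvNorm (ofSigned hd α (μ.restrict (⋃ i, U i)ᶜ)) + ∑ i, tvNorm (ν i) := by
    have hm : MeasurableSet (⋃ i, U i) := MeasurableSet.iUnion hU
    rw [tvNorm_ofSigned_restrict hd _ hm.compl,
      Finset.sum_congr rfl fun i _ => tvNorm_ofSigned_restrict hd μ (hU i),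
      ← measureReal_iUnion_fintype hdisj hU, add_comm, measureReal_add_measureReal_compl hm]
    rfl
  have hle : ∀ c : Fin (M + 1) → ℝ, (∀ i, |c i| ≤ 1) →
      tvNorm (f + ∑ i, c i • ν i) ≤ tvNorm f + ∑ i, c i * tvNorm (ν i) := by
    intro c hc
    have h1 : f + ∑ i, c i • ν i
        = ofSigned hd α (μ.restrict (⋃ i, U i)ᶜ) + ∑ i, (1 + c i) • ν i := by
      conv_lhs => rw [hdecomp]
      rw [add_assoc, ← Finset.sum_add_distrib]
      simp only [add_smul, one_smul]
    rw [h1, hN, add_assoc, ← Finset.sum_add_distrib]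
    refine (tvNorm_add_le hd _ _).trans
      (add_le_add le_rfl ((tvNorm_sum_smul_le hd _ _ _).trans (le_of_eq ?_)))
    refine Finset.sum_congr rfl fun i _ => ?_
    rw [abs_of_nonneg (by linarith [neg_le_of_abs_le (hc i)])]
    ring
  set h : NativeSpace d α := ∑ i, t i • ν i with hh
  have hPh : ∀ m, P m h = 0 := fun m => by
    have := congrFun ht m
    simpa [T, Fintype.linearCombination_apply, hh] using this
  have hDadd : (fun m => P m (f + h)) = fun m => P m f := by
    ext m; rw [map_add, hPh, add_zero]
  have hDsub : (fun m => P m (f + -h)) = fun m => P m f := by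
    ext m; rw [map_add, map_neg, hPh, neg_zero, add_zero]
  -- The norm grows by at most `c` along `h` and by at most `-c` along `-h`, where
  -- `c = ∑ tᵢ ‖νᵢ‖`; minimality of `f` then forces `c = 0`.
  have hadd := hle t ht1
  have hsub := hle (-t) fun i => by rw [Pi.neg_apply, abs_neg]; exact ht1 i
  have hneg : ∑ i, (-t) i • ν i = -h := by
    rw [hh, ← Finset.sum_neg_distrib]
    exact Finset.sum_congr rfl fun i _ => by rw [Pi.neg_apply, neg_smul]
  have hneg2 : ∑ i, (-t) i * tvNorm (ν i) = -∑ i, t i * tvNorm (ν i) := by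
    rw [← Finset.sum_neg_distrib]
    exact Finset.sum_congr rfl fun i _ => by rw [Pi.neg_apply, neg_mul]
  rw [hneg, hneg2] at hsub
  rw [← hh] at hadd
  have hmin := hf.1
  have m1 := hmin (f + h)
  have m2 := hmin (f + -h)
  rw [hDadd, add_le_add_iff_left, mul_le_mul_iff_of_pos_left hlam] at m1
  rw [hDsub, add_le_add_iff_left, mul_le_mul_iff_of_pos_left hlam] at m2
  have hmem : ∀ k : NativeSpace d α, (fun m => P m k) = (fun m => P m f) →
      tvNorm k ≤ tvNorm f → k ∈ {f : NativeSpace d α | ∀ g : NativeSpace d α,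
      D (fun m => P m f) + lam * tvNorm f ≤ D (fun m => P m g) + lam * tvNorm g} := by
    intro k hk hk' g
    refine le_trans ?_ (hmin g)
    rw [hk]
    gcongr
  have hfh : f + h = f := by
    refine hf.2 (hmem (f + h) hDadd (by linarith)) (hmem (f + -h) hDsub (by linarith)) ?_
    refine ⟨1 / 2, 1 / 2, by norm_num, by norm_num, by norm_num, ?_⟩
    rw [← smul_add, add_add_add_comm, add_neg_cancel, add_zero, ← two_smul ℝ f, smul_smul]
    norm_num
  have h0 : ∑ i, t i • μ.restrict (U i) = 0 := by
    have h1 : h = 0 := by simpa using hfh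
    apply (ofSigned hd α).injective
    rw [map_zero, ← h1, hh, map_sum]
    exact Finset.sum_congr rfl fun i _ => by rw [map_smul]
  obtain ⟨j, hj⟩ := Function.ne_iff.1 ht0
  apply hpos j
  have hz : μ.restrict (U j) = 0 := by
    ext s hs
    rw [VectorMeasure.restrict_apply _ (hU j) hs, zero_apply]
    have h2 := congrArg (fun v : SignedMeasure (E d) => v (s ∩ U j)) h0
    simp only [FunLike.coe_sum, Finset.sum_apply, FunLike.coe_smul,
      Pi.smul_apply, FunLike.coe_zero, Pi.zero_apply] at h2
    rw [Finset.sum_eq_single j, VectorMeasure.restrict_apply _ (hU j) (hs.inter (hU j)),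
      inter_assoc, inter_self, smul_eq_mul] at h2
    · exact (mul_eq_zero.1 h2).resolve_left hj
    · intro i _ hij
      rw [VectorMeasure.restrict_apply _ (hU i) (hs.inter (hU j)), inter_assoc,
        (hdisj hij.symm).inter_eq, inter_empty, VectorMeasure.empty, smul_zero]
    · simp
  have h3 := VectorMeasure.variation_restrict (μ := μ) (hU j)
  rw [hz, VectorMeasure.variation_zero] at h3
  rw [← Measure.restrict_apply_univ, ← h3]
  rfl

/-- Distinct points of the support have disjoint neighbourhoods of nonzero measure. -/
lemma encard_support_le_of_disjoint (m : Measure (E d)) {M : ℕ}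
    (h : ∀ U : Fin (M + 1) → Set (E d), (∀ i, MeasurableSet (U i)) → Pairwise (Function.onFun Disjoint U) →
      ¬ ∀ i, m (U i) ≠ 0) : m.support.encard ≤ M := by
  by_contra! hlt
  obtain ⟨s, hs, hcard⟩ := exists_subset_encard_eq
    (show ((M + 1 : ℕ) : ℕ∞) ≤ m.support.encard by
      rw [Nat.cast_succ]; exact Order.add_one_le_of_lt hlt)
  have hsf : s.Finite := finite_of_encard_eq_coe hcard
  obtain ⟨V, hV, hVd⟩ := hsf.t2_separation
  have hsn : s.ncard = M + 1 := by rw [ncard_def, hcard]; rfl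
  have : Finite s := hsf
  let e : Fin (M + 1) ≃ s := (Finite.equivFinOfCardEq (by rwa [Nat.card_coe_set_eq])).symm
  refine h (fun i => V (e i)) (fun i => (hV _).2.measurableSet) (fun i j hij => ?_) fun i => ?_
  · exact hVd (e i).2 (e j).2 fun h => hij (e.injective (Subtype.ext h))
  · exact ((Measure.mem_support_iff_forall _).1 (hs (e i).2) _
      ((hV _).2.mem_nhds (hV _).1)).ne'

/-- A finite signed measure with finite support is a combination of Dirac masses. -/
lemma eq_sum_dirac_of_encard_support_le (μ : SignedMeasure (E d)) {M : ℕ}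
    (h : μ.variation.support.encard ≤ M) :
    ∃ K : ℕ, K ≤ M ∧ ∃ (a : Fin K → ℝ) (c : Fin K → E d),
      μ = ∑ k, a k • VectorMeasure.dirac (c k) (1 : ℝ) := by
  set F := μ.variation.support with hF
  have hfin : F.Finite := finite_of_encard_le_coe h
  have : Finite F := hfin
  let e : Fin (Nat.card F) ≃ F := (Finite.equivFin F).symm
  refine ⟨Nat.card F, ?_, fun k => μ {(e k : E d)}, fun k => e k, ?_⟩
  · rw [Nat.card_coe_set_eq, ← Nat.cast_le (α := ℕ∞), hfin.cast_ncard_eq]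
    exact h
  have hUn : ⋃ k, {(e k : E d)} = F := by
    ext z
    simp only [mem_iUnion, mem_singleton_iff]
    exact ⟨fun ⟨k, hk⟩ => hk ▸ (e k).2, fun hz => ⟨e.symm ⟨z, hz⟩, by rw [e.apply_symm_apply]⟩⟩
  have h1 := eq_restrict_compl_add_sum_restrict μ (U := fun k => {(e k : E d)})
    (fun k => measurableSet_singleton _) fun i j hij => by
      simpa [Function.onFun] using fun h => hij (e.injective (Subtype.ext h))
  have h2 : μ.restrict (⋃ k, {(e k : E d)})ᶜ = 0 := by
    rw [hUn]
    ext s hs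
    rw [VectorMeasure.restrict_apply _ hfin.measurableSet.compl hs, zero_apply,
      ← enorm_eq_zero, ← nonpos_iff_eq_zero]
    refine (μ.enorm_measure_le_variation _).trans ?_
    rw [measure_mono_null inter_subset_right Measure.measure_compl_support]
  rw [h2, zero_add] at h1
  conv_lhs => rw [h1]
  refine Finset.sum_congr rfl fun k _ => ?_
  ext s hs
  rw [VectorMeasure.restrict_singleton, smul_apply, smul_eq_mul]
  by_cases hk : (e k : E d) ∈ s
  · rw [VectorMeasure.dirac_apply_of_mem hs hk, VectorMeasure.dirac_apply_of_mem hs hk, mul_one]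
  · rw [VectorMeasure.dirac_apply_of_notMem hk, VectorMeasure.dirac_apply_of_notMem hk, mul_zero]

end Liz

theorem mainTheorem6 (d : ℕ) (hd : 0 < d) (α : ℝ) (hα : (d : ℝ) < α)
    (hαd : ∀ n : ℕ, α - d ≠ n)
    (χ : ℝ → ℝ) (hχ : ContDiff ℝ ∞ χ) (hχ0 : ∀ t, |t| ≤ 1 → χ t = 0) (hχ1 : ∀ t, 2 ≤ |t| → χ t = 1)
    (L : ℝ → ℝ → ℝ) (hL : ∀ y, StrictConvexOn ℝ Set.univ (L y))
    (hLb : ∀ y, BddBelow (Set.range (L y)))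
    (lam : ℝ) (hlam : 0 < lam) (M : ℕ) (x : Fin M → Liz.E d) (y : Fin M → ℝ)
    (S : Set (Liz.NativeSpace d α)) (hS : S = Liz.solutionSet d α χ L lam x y) :
    S.Nonempty ∧ IsCompact S ∧
      S = closure (convexHull ℝ (Set.extremePoints ℝ S)) ∧
      ∀ f ∈ Set.extremePoints ℝ S, ∃ K : ℕ, K ≤ M ∧ ∃ (a : Fin K → ℝ) (c : Fin K → Liz.E d),
        f.toDist = ∑ k, a k • Liz.fracLapDist d (-α)
            (Liz.ofMeasure d (MeasureTheory.VectorMeasure.dirac (c k) 1)) ∧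
        (∀ z, Liz.represent χ f z
            = ∑ k, a k * (Liz.rho d α (z - c k) - Liz.corrPoly d α χ (c k) z)) ∧
        Liz.IsClassOf f.toDist
            (fun z => ∑ k, a k * (Liz.rho d α (z - c k) - Liz.corrPoly d α χ (c k) z)) ∧
        ∀ k, Liz.IsPolyOfDegreeLE (Liz.deg d α) (Liz.corrPoly d α χ (c k)) := by
  have hχc := hχ.continuous
  choose P hP hPc hPd using fun z => Liz.exists_linearMap_represent hd hα hαd hχc hχ0 hχ1 z
  let D : (Fin M → ℝ) → ℝ := fun u => ∑ m, L (y m) (u m)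
  have hSD : S = {f : Liz.NativeSpace d α | ∀ g : Liz.NativeSpace d α,
      D (fun m => P (x m) f) + lam * Liz.tvNorm f
        ≤ D (fun m => P (x m) g) + lam * Liz.tvNorm g} := by
    rw [hS]
    simp only [Liz.solutionSet, Liz.objective, Liz.tvNorm_eq hd, D, hP]
  have := Liz.isTopologicalAddGroup_nativeSpace (α := α) hd
  have := Liz.continuousSMul_nativeSpace (α := α) hd
  have := Liz.locallyConvexSpace_nativeSpace (α := α) hd
  have := Liz.t2Space_nativeSpace (α := α) hd
  have hDcont : Continuous fun f : Liz.NativeSpace d α => D (fun m => P (x m) f) := by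
    refine continuous_finsetSum _ fun m _ => Continuous.comp ?_ (hPc (x m))
    exact continuousOn_univ.1 ((hL (y m)).convexOn.continuousOn isOpen_univ)
  choose b hb using hLb
  have hDb : ∀ f : Liz.NativeSpace d α, ∑ m, b (y m) ≤ D (fun m => P (x m) f) := fun f =>
    Finset.sum_le_sum fun m _ => hb (y m) (mem_range_self _)
  have : Inhabited (Liz.NativeSpace d α) := ⟨0⟩
  obtain ⟨hne, hcomp⟩ := Liz.exists_minimizer_and_isCompact
    (Liz.lowerSemicontinuous_tvNorm (α := α) hd)
    (Liz.exists_isCompact_superset_tvNorm_le hd) hDcont hDb hlam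
  rw [← hSD] at hne hcomp
  refine ⟨hne, hcomp, (closure_convexHull_extremePoints hcomp ?_).symm, fun f hf => ?_⟩
  · have hconv : ConvexOn ℝ univ fun f : Liz.NativeSpace d α =>
        D (fun m => P (x m) f) + lam * Liz.tvNorm f := by
      refine ConvexOn.add ⟨convex_univ, fun f _ g _ a b ha hb hab => ?_⟩
        ((Liz.convexOn_tvNorm hd).smul hlam.le)
      simp only [D, Finset.smul_sum, ← Finset.sum_add_distrib, map_add, map_smul]
      exact Finset.sum_le_sum fun m _ =>
        (hL (y m)).convexOn.2 (mem_univ _) (mem_univ _) ha hb hab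
    rw [hSD, ofPred_forall]
    refine convex_iInter fun g => ?_
    simpa using hconv.convex_le (D (fun m => P (x m) g) + lam * Liz.tvNorm g)
  rw [hSD] at hf
  obtain ⟨K, hK, a, c, hac⟩ := Liz.eq_sum_dirac_of_encard_support_le f.measure
    (Liz.encard_support_le_of_disjoint _ fun U hU hdisj hpos =>
      Liz.not_extreme_of_disjoint hd (fun m => P (x m)) D hlam hf hU hdisj hpos)
  have hdist : f.toDist = ∑ k, a k • Liz.fracLapDist d (-α)
      (Liz.ofMeasure d (MeasureTheory.VectorMeasure.dirac (c k) 1)) := by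
    rw [← f.measure_spec, hac, map_sum, map_sum]
    exact Finset.sum_congr rfl fun k _ => by
      rw [map_smul, ← LinearMap.restrictScalars_apply ℝ, map_smul]; rfl
  refine ⟨K, hK, a, c, hdist, fun z => ?_, ?_, fun k => Liz.isPolyOfDegreeLE_corrPoly α χ (c k)⟩
  · rw [← hP, ← Liz.ofSigned_measure hd f, hac, map_sum, map_sum]
    exact Finset.sum_congr rfl fun k _ => by rw [map_smul, map_smul, hPd]; rfl
  · rw [hdist]
    exact Liz.IsClassOf.sum_smul _
      (fun k _ => Liz.isClassOf_fracLapDist_dirac hα hαd hd χ (c k)) a
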